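/- Let $M$ be a smooth Riemannian manifold of dimension $n\ge 1$ with Riemannian distance $d$, let $x_0\in M$ and $R>0$, and assume that the balls $B_r(x_0)$, $0<r\le R$, are geodesic balls: the exponential map $\exp_{x_0}$ is defined on the ball $B_r(0)\subset T_{x_0}M$ and maps it diffeomorphically onto $B_r(x_0)$ (that is, $R$ does not exceed the injectivity radius at $x_0$). Identify $T_{x_0}M$ with $\mathbb R^n$ by an orthonormal frame, let $\Phi=\exp_{x_0}:B_R(0)\subset\mathbb R^n\to B_R(x_0)$ be the exponential coordinates, and write the Laplacian of $M$ in these coordinates as $$\Delta = A^{ij}(\xi)\,\partial_i\partial_j + B^i(\xi)\,\partial_i ,\qquad A^{ij}=g^{ij},\quad B^k=-g^{ij}\Gamma^k_{ij}.$$ A function $v$ with values in $(-\infty,+\infty]$ is called superharmonic with respect to a linear second order operator $L$ (without zeroth order term, coefficients not assumed continuous) if it is lower semicontinuous and $L\varphi(p)\le 0$ whenever a $C^2$ function $\varphi$ satisfies $\varphi(p)=v(p)$ and $\varphi\le v$ near $p$; it is called superharmonic if this holds with $L=\Delta$. Let $v:B_R(x_0)\to(-\infty,+\infty]$ be (lower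 semicontinuous and) superharmonic, and let $$\tilde v(x)=\inf\{v(y): d(y,x_0)=d(x,x_0)\}$$ be its maximal radial function. Then: (1) For each $r\in[0,R)$ there is a point $x_r$ with $d(x_r,x_0)=r$ and $\tilde v(x_r)=v(x_r)$. (2) Let such points $x_r$, $0\le r<R$, be chosen in any way, and let $\xi_r\in B_R(0)$, $|\xi_r|=r$, be the exponential coordinates of $x_r$. There is a linear operator $L=a^{ij}(x)\partial_i\partial_j+b^i(x)\partial_i$ on $B_R(0)$ which is elliptic (the matrix $(a^{ij}(x))$ is symmetric and positive definite at every $x$) and rotationally symmetric ($L(u\circ Q)=(Lu)\circ Q$ for all $Q\in O(n)$ and all $C^2$ functions $u$), such that $\tilde v\circ\Phi$ is superharmonic with respect to $L$ in $B_R(0)$, and the coefficients of $L$ at each point $x$ equal those of the Laplacian at $x_r$, $r=|x|$, in the sense of rotationally symmetric operators: with $\xi=\xi_{|x|}$, $$a^{ij}(x)x_ix_j=A^{ij}(\xi)\xi_i\xi_j,\qquad \operatorname{tr}a(x)=\operatorname{tr}A(\xi),\qquad b^i(x)x_i=B^i(\xi)\xi_i$$ (for a rotationally symmetric operator with symmetric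 $a$ these quantities determine $a(x)$ and $b(x)$; in particular $Lu(x)=\Delta (u\circ\Phi^{-1})(x_r)$ for every radial $C^2$ function $u$). (3) For every choice of $Q_x\in O(n)$, $x\in B_R(0)$, with $Q_x\,\xi_{|x|}=x$, the function $\tilde v\circ\Phi$ is also superharmonic in $B_R(0)$ with respect to the elliptic operator whose coefficients at $x$ are those of the Laplacian at $x_r$, $r=|x|$, carried over by $Q_x$, namely $a(x)=Q_xA(\xi_{|x|})Q_x^{T}$ and $b(x)=Q_xB(\xi_{|x|})$. -/

import Mathlib

open Set Filter Bundle
open scoped Manifold ContDiff Topology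

noncomputable section

namespace MaxRadial

/-! ### Second order linear operators on Euclidean space -/

/-- The partial derivative `∂ᵢ u (x)`. -/
def partialD {n : ℕ} (i : Fin n) (u : EuclideanSpace ℝ (Fin n) → ℝ)
    (x : EuclideanSpace ℝ (Fin n)) : ℝ :=
  fderiv ℝ u x (EuclideanSpace.single i 1)

/-- The linear differential operator `u ↦ ∑ aⁱʲ(x) ∂ᵢ∂ⱼ u + ∑ bⁱ(x) ∂ᵢ u`, given by its
coefficients (no regularity of the coefficients is required). -/
structure LinOp (n : ℕ) where
  a : EuclideanSpace ℝ (Fin n) → Matrix (Fin n) (Fin n) ℝ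
  b : EuclideanSpace ℝ (Fin n) → EuclideanSpace ℝ (Fin n)

namespace LinOp

variable {n : ℕ}

/-- The value `(L u)(x)`. -/
def apply (L : LinOp n) (u : EuclideanSpace ℝ (Fin n) → ℝ) (x : EuclideanSpace ℝ (Fin n)) : ℝ :=
  ∑ i, ∑ j, L.a x i j * partialD i (partialD j u) x + ∑ i, L.b x i * partialD i u x

/-- Ellipticity: the second order coefficients form a positive definite symmetric matrix. -/
def IsEllipticOn (L : LinOp n) (U : Set (EuclideanSpace ℝ (Fin n))) : Prop :=
  ∀ x ∈ U, (L.a x).PosDef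

/-- Rotational symmetry on the ball `B_R(0)`: the operator commutes with all linear isometries,
`L (u ∘ Q) = (L u) ∘ Q` for `Q ∈ O(n)`. -/
def IsRotSymmOn (L : LinOp n) (R : ℝ) : Prop :=
  ∀ Q : EuclideanSpace ℝ (Fin n) ≃ₗᵢ[ℝ] EuclideanSpace ℝ (Fin n),
    ∀ x ∈ Metric.ball (0 : EuclideanSpace ℝ (Fin n)) R,
      ∀ u : EuclideanSpace ℝ (Fin n) → ℝ, ContDiffAt ℝ 2 u (Q x) →
        L.apply (u ∘ Q) x = L.apply u (Q x)

/-- `w` is superharmonic with respect to `L` in `U` (viscosity sense): `w` is lower semicontinuous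
with values in `(-∞, +∞]`, and `L φ (x) ≤ 0` whenever the `C²` function `φ` touches `w` from below
at the point `x ∈ U`. -/
def IsSuperharmonicOn (L : LinOp n) (w : EuclideanSpace ℝ (Fin n) → EReal)
    (U : Set (EuclideanSpace ℝ (Fin n))) : Prop :=
  LowerSemicontinuousOn w U ∧ (∀ x ∈ U, ⊥ < w x) ∧
    ∀ x ∈ U, ∀ φ : EuclideanSpace ℝ (Fin n) → ℝ, ContDiffAt ℝ 2 φ x →
      (φ x : EReal) = w x → (∀ᶠ y in 𝓝 x, (φ y : EReal) ≤ w y) → L.apply φ x ≤ 0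

/-- The coefficients of `L` at `x` and of `L'` at `ξ` (where `|ξ| = |x|`) agree as coefficients
of rotationally symmetric operators: they have the same radial second order coefficient, the same
trace (hence the same total tangential second order coefficient), and the same radial first order
coefficient. If `L` is rotationally symmetric with symmetric `L.a`, these three numbers
determine `L.a x` and `L.b x`. -/
def SameRotCoeff (L : LinOp n) (x : EuclideanSpace ℝ (Fin n))
    (L' : LinOp n) (ξ : EuclideanSpace ℝ (Fin n)) : Prop :=
  (∑ i, ∑ j, L.a x i j * x i * x j = ∑ i, ∑ j, L'.a ξ i j * ξ i * ξ j) ∧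
  (L.a x).trace = (L'.a ξ).trace ∧
  ∑ i, L.b x i * x i = ∑ i, L'.b ξ i * ξ i

/-- The matrix of a linear isometry in the standard basis. -/
def rotMatrix (Q : EuclideanSpace ℝ (Fin n) ≃ₗᵢ[ℝ] EuclideanSpace ℝ (Fin n)) :
    Matrix (Fin n) (Fin n) ℝ :=
  Matrix.of fun k i => Q (EuclideanSpace.single i 1) k

/-- The operator whose coefficients at `x` are those of `L` at `ξ x`, carried over by the
isometry `Q x`. -/
def transport (L : LinOp n) (ξ : EuclideanSpace ℝ (Fin n) → EuclideanSpace ℝ (Fin n))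
    (Q : EuclideanSpace ℝ (Fin n) → EuclideanSpace ℝ (Fin n) ≃ₗᵢ[ℝ] EuclideanSpace ℝ (Fin n)) :
    LinOp n where
  a x := rotMatrix (Q x) * L.a (ξ x) * (rotMatrix (Q x)).transpose
  b x := Q x (L.b (ξ x))

end LinOp

/-! ### Riemannian geometry in local coordinates -/

section Riemannian

variable {n : ℕ} {M : Type*} [MetricSpace M] [ChartedSpace (EuclideanSpace ℝ (Fin n)) M]
  [RiemannianBundle (fun x : M => TangentSpace (𝓡 n) x)]

/-- The metric coefficients `g_{ij}(x)` in the local parametrization `Φ`. -/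
def metricCoeff (Φ : EuclideanSpace ℝ (Fin n) → M) (x : EuclideanSpace ℝ (Fin n)) :
    Matrix (Fin n) (Fin n) ℝ :=
  Matrix.of fun i j =>
    inner ℝ (mfderiv (𝓡 n) (𝓡 n) Φ x (EuclideanSpace.single i (1 : ℝ)))
      (mfderiv (𝓡 n) (𝓡 n) Φ x (EuclideanSpace.single j (1 : ℝ)))

/-- The Christoffel symbol
`Γᵏᵢⱼ = ½ ∑ₗ gᵏˡ (∂ᵢ gⱼₗ + ∂ⱼ gᵢₗ - ∂ₗ gᵢⱼ)` in the local parametrization `Φ`. -/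
def christoffel (Φ : EuclideanSpace ℝ (Fin n) → M) (x : EuclideanSpace ℝ (Fin n))
    (k i j : Fin n) : ℝ :=
  (1 / 2 : ℝ) * ∑ l, (metricCoeff Φ x)⁻¹ k l *
    (partialD i (fun y => metricCoeff Φ y j l) x + partialD j (fun y => metricCoeff Φ y i l) x
      - partialD l (fun y => metricCoeff Φ y i j) x)

/-- The Laplace-Beltrami operator in the local parametrization `Φ`:
`Δ = ∑ gⁱʲ ∂ᵢ∂ⱼ - ∑ gⁱʲ Γᵏᵢⱼ ∂ₖ`. -/
def laplaceIn (Φ : EuclideanSpace ℝ (Fin n) → M) : LinOp n where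
  a x := (metricCoeff Φ x)⁻¹
  b x := WithLp.toLp 2 fun k => -∑ i, ∑ j, (metricCoeff Φ x)⁻¹ i j * christoffel Φ x k i j

/-- The Laplace-Beltrami operator on functions on `M`, computed at `p` in the preferred chart
at `p`. -/
def laplacian (f : M → ℝ) (p : M) : ℝ :=
  (laplaceIn (extChartAt (𝓡 n) p).symm).apply (f ∘ (extChartAt (𝓡 n) p).symm)
    (extChartAt (𝓡 n) p p)

variable (n) in
/-- `v` is superharmonic in the open set `U` (viscosity sense): `v` is lower semicontinuous
with values in `(-∞, +∞]`, and `Δ φ (p) ≤ 0` whenever the `C²` function `φ` touches `v` from below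
at the point `p ∈ U`. -/
def IsSuperharmonicOn (v : M → EReal) (U : Set M) : Prop :=
  LowerSemicontinuousOn v U ∧ (∀ p ∈ U, ⊥ < v p) ∧
    ∀ p ∈ U, ∀ φ : M → ℝ, ContMDiffAt (𝓡 n) 𝓘(ℝ, ℝ) 2 φ p →
      (φ p : EReal) = v p → (∀ᶠ q in 𝓝 p, (φ q : EReal) ≤ v q) → laplacian (n := n) φ p ≤ 0

variable (n) in
/-- `γ` is a geodesic on the open set `s ⊆ ℝ`: it is `C²` and satisfies the geodesic equation
`c''ᵏ + ∑ Γᵏᵢⱼ(c) c'ⁱ c'ʲ = 0` at every `t ∈ s`, where `c` is `γ` read in the preferred chart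
at `γ t`. -/
def IsGeodesicOn (γ : ℝ → M) (s : Set ℝ) : Prop :=
  ContMDiffOn 𝓘(ℝ, ℝ) (𝓡 n) 2 γ s ∧
    ∀ t ∈ s, ∀ k : Fin n,
      deriv (deriv (extChartAt (𝓡 n) (γ t) ∘ γ)) t k +
        ∑ i, ∑ j, christoffel (extChartAt (𝓡 n) (γ t)).symm (extChartAt (𝓡 n) (γ t) (γ t)) k i j *
          deriv (extChartAt (𝓡 n) (γ t) ∘ γ) t i * deriv (extChartAt (𝓡 n) (γ t) ∘ γ) t j = 0

/-- `q = γ(1)` for a geodesic `γ`, defined on (a neighbourhood of) `[0, 1]`, with `γ(0) = x₀` and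
`γ'(0) = w`. -/
def IsGeodesicEndpoint (x₀ : M) (w : TangentSpace (𝓡 n) x₀) (q : M) : Prop :=
  ∃ (γ : ℝ → M) (s : Set ℝ), IsOpen s ∧ Icc 0 1 ⊆ s ∧ IsGeodesicOn n γ s ∧
    (⟨γ 0, mfderiv 𝓘(ℝ, ℝ) (𝓡 n) γ 0 (1 : ℝ)⟩ : TangentBundle (𝓡 n) M) = ⟨x₀, w⟩ ∧ γ 1 = q

open Classical in
/-- The Riemannian exponential map at `x₀` (with value `x₀` where it is not defined). -/
def expMap (x₀ : M) (w : TangentSpace (𝓡 n) x₀) : M :=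
  if h : ∃ q, IsGeodesicEndpoint x₀ w q then h.choose else x₀

variable (n) in
/-- The metric ball `B_r(x₀)` is a geodesic ball: the exponential map at `x₀` is defined on
the ball `B_r(0)` of the tangent space and maps it diffeomorphically onto `B_r(x₀)`. -/
def IsGeodesicBall (x₀ : M) (r : ℝ) : Prop :=
  (∀ w ∈ Metric.ball (0 : TangentSpace (𝓡 n) x₀) r, ∃ q, IsGeodesicEndpoint x₀ w q) ∧
    ∃ e : PartialDiffeomorph 𝓘(ℝ, TangentSpace (𝓡 n) x₀) (𝓡 n) (TangentSpace (𝓡 n) x₀) M ∞,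
      e.source = Metric.ball 0 r ∧ e.target = Metric.ball x₀ r ∧
        EqOn e.toFun (expMap x₀) (Metric.ball 0 r)

/-- Exponential (normal) coordinates at `x₀` with respect to the orthonormal frame `ι` of the
tangent space at `x₀`. -/
def expCoord (x₀ : M) (ι : EuclideanSpace ℝ (Fin n) ≃ₗᵢ[ℝ] TangentSpace (𝓡 n) x₀) :
    EuclideanSpace ℝ (Fin n) → M :=
  fun x => expMap x₀ (ι x)

end Riemannian

/-- The maximal radial function `ṽ(x) = inf {v(y) : d(y, x₀) = d(x, x₀)}` of `v`. -/
def maximalRadial {M : Type*} [MetricSpace M] (v : M → EReal) (x₀ x : M) : EReal :=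
  ⨅ y ∈ Metric.sphere x₀ (dist x x₀), v y

end MaxRadial

end

/-! Let `φ` be `C²` and touch the radial function `ṽ ∘ Φ` from below at `x`, put `r = |x|`, and let
`ξ` be the coordinates of a minimum point `x_r` of `v` on the geodesic sphere of radius `r`. For
every `Q ∈ O(n)` with `Q ξ = x`, the function `φ ∘ Q ∘ Φ⁻¹` touches `v` from below at `x_r`: it lies
below `ṽ ≤ v` near `x_r` because `ṽ` depends only on the distance to `x₀`, and it equals `v` at
`x_r` because the infimum is attained there. Superharmonicity of `v` gives `Δ(φ ∘ Q ∘ Φ⁻¹)(x_r) ≤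
0`. In exponential coordinates this is `L₀(φ ∘ Q)(ξ) ≤ 0` with `L₀ = laplaceIn Φ`
(`IsPolarDiffeo.laplaceIn_apply_comp_nonpos`).

For a single `Q` per point this is claim (3): conjugating the coefficients of `L₀` by `Q` turns the
inequality into one for the transported operator. For claim (2) it is averaged over finitely many
such `Q`. An integral over the stabilizer of a direction is unnecessary: the signed permutations
fixing a basis vector `e` already average every matrix to `α e eᵀ + β (1 - e eᵀ)` and every vector
to a multiple of `e` (`exists_average`). The averaged coefficients are those of a rotationally
symmetric operator, `rotSymmOp`; the average preserves positivity, trace and radial coefficients,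
and carries the inequality along.

Two geometric facts support this. The Laplacian is defined in the preferred chart, so it must be
moved to exponential coordinates; the invariance follows from the transformation law of the
Christoffel symbols, derived from the Koszul formula (`koszul_transform`, `laplaceIn_comp`,
`laplacian_eq_laplaceIn`). And `Φ` must carry Euclidean spheres to metric spheres, which follows
from the hypothesis that all balls of radius at most `R` are geodesic (`exists_isPolarDiffeo`). -/

noncomputable section

namespace MaxRadial

/-! ### Second derivatives in coordinates -/

section Coordinates

variable {n : ℕ}

/-- The standard basis vectors of `EuclideanSpace ℝ (Fin n)`. -/
abbrev stdVec (i : Fin n) : EuclideanSpace ℝ (Fin n) := EuclideanSpace.single i (1 : ℝ)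

theorem sum_smul_stdVec (v : EuclideanSpace ℝ (Fin n)) : ∑ i, v i • stdVec i = v := by
  ext k
  simp [Finset.sum_apply, Pi.single_apply]

theorem partialD_partialD {u : EuclideanSpace ℝ (Fin n) → ℝ} {x : EuclideanSpace ℝ (Fin n)}
    (hu : ContDiffAt ℝ 2 u x) (i j : Fin n) :
    partialD i (partialD j u) x = fderiv ℝ (fderiv ℝ u) x (stdVec i) (stdVec j) := by
  have h : DifferentiableAt ℝ (fderiv ℝ u) x :=
    (hu.fderiv_right (m := 1) (by norm_num)).differentiableAt (by norm_num)
  unfold partialD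
  rw [fderiv_clm_apply h (differentiableAt_const _)]
  simp

theorem sum_mul_partialD (u : EuclideanSpace ℝ (Fin n) → ℝ) (x b : EuclideanSpace ℝ (Fin n)) :
    ∑ i, b i * partialD i u x = fderiv ℝ u x b := by
  conv_rhs => rw [← sum_smul_stdVec b]
  simp [partialD]

theorem LinOp.apply_eq (L : LinOp n) {u : EuclideanSpace ℝ (Fin n) → ℝ}
    {x : EuclideanSpace ℝ (Fin n)} (hu : ContDiffAt ℝ 2 u x) :
    L.apply u x =
      ∑ i, ∑ j, L.a x i j * fderiv ℝ (fderiv ℝ u) x (stdVec i) (stdVec j)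
        + fderiv ℝ u x (L.b x) := by
  unfold LinOp.apply
  rw [sum_mul_partialD]
  simp only [partialD_partialD hu]

theorem LinOp.apply_congr (L : LinOp n) {u w : EuclideanSpace ℝ (Fin n) → ℝ}
    {x : EuclideanSpace ℝ (Fin n)} (h : u =ᶠ[𝓝 x] w) : L.apply u x = L.apply w x := by
  have h1 : ∀ j, partialD j u =ᶠ[𝓝 x] partialD j w := fun j ↦
    (h.fderiv (𝕜 := ℝ)).mono fun y hy ↦ by simp only [partialD, hy]
  simp only [LinOp.apply]
  congr 1
  · refine Finset.sum_congr rfl fun i _ ↦ Finset.sum_congr rfl fun j _ ↦ ?_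
    simp only [partialD]
    rw [(h1 j).fderiv_eq]
  · exact Finset.sum_congr rfl fun i _ ↦ by rw [(h1 i).eq_of_nhds]

/-- The term with the second derivative of `ψ` is what keeps the plain Hessian from being a tensor.
Under a change of coordinates it is cancelled by the Christoffel symbols; for a linear isometry it
vanishes. -/
theorem fderiv_fderiv_comp {E F G : Type*} [NormedAddCommGroup E] [NormedSpace ℝ E]
    [NormedAddCommGroup F] [NormedSpace ℝ F] [NormedAddCommGroup G] [NormedSpace ℝ G]
    {u : F → G} {ψ : E → F} {x : E} (hψ : ContDiffAt ℝ 2 ψ x) (hu : ContDiffAt ℝ 2 u (ψ x))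
    (v w : E) :
    fderiv ℝ (fderiv ℝ (u ∘ ψ)) x v w =
      fderiv ℝ (fderiv ℝ u) (ψ x) (fderiv ℝ ψ x v) (fderiv ℝ ψ x w)
        + fderiv ℝ u (ψ x) (fderiv ℝ (fderiv ℝ ψ) x v w) := by
  have hψ' : DifferentiableAt ℝ (fderiv ℝ ψ) x :=
    (hψ.fderiv_right (m := 1) (by norm_num)).differentiableAt (by norm_num)
  have hu' : DifferentiableAt ℝ (fderiv ℝ u) (ψ x) :=
    (hu.fderiv_right (m := 1) (by norm_num)).differentiableAt (by norm_num)
  have hψ1 : DifferentiableAt ℝ ψ x := hψ.differentiableAt (by norm_num)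
  have h : fderiv ℝ (u ∘ ψ) =ᶠ[𝓝 x] fun y ↦ (fderiv ℝ u (ψ y)).comp (fderiv ℝ ψ y) := by
    have e1 : ∀ᶠ y in 𝓝 x, DifferentiableAt ℝ ψ y :=
      (hψ.eventually (by simp)).mono fun y hy ↦ hy.differentiableAt (by norm_num)
    have e2 : ∀ᶠ y in 𝓝 x, DifferentiableAt ℝ u (ψ y) :=
      hψ.continuousAt.eventually
        ((hu.eventually (by simp)).mono fun y hy ↦ hy.differentiableAt (by norm_num))
    filter_upwards [e1, e2] with y h1 h2
    exact fderiv_comp y h2 h1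
  have hc := ((hu'.hasFDerivAt.comp x hψ1.hasFDerivAt).clm_comp hψ'.hasFDerivAt)
  rw [h.fderiv_eq, HasFDerivAt.fderiv (by exact hc)]
  simp [add_comm]

end Coordinates

/-! ### Christoffel symbols under a change of coordinates -/

set_option synthInstance.maxHeartbeats 400000 in
/-- If the metric `B₂` is the pull-back of `B₁` under `ψ`, then the vectors given by the Koszul
formula satisfy the transformation law of the Christoffel symbols. -/
theorem koszul_transform {E F : Type*} [NormedAddCommGroup E] [NormedSpace ℝ E]
    [NormedAddCommGroup F] [NormedSpace ℝ F]
    {B₁ : F → F →L[ℝ] F →L[ℝ] ℝ} {B₂ : E → E →L[ℝ] E →L[ℝ] ℝ} {ψ : E → F} {x : E}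
    (hψ : ContDiffAt ℝ 2 ψ x) (hsurj : Function.Surjective (fderiv ℝ ψ x))
    (hB₁ : DifferentiableAt ℝ B₁ (ψ x))
    (hB : ∀ᶠ y in 𝓝 x, ∀ v w, B₂ y v w = B₁ (ψ y) (fderiv ℝ ψ y v) (fderiv ℝ ψ y w))
    (hB₂ : DifferentiableAt ℝ B₂ x)
    (hsymm : ∀ v w, B₁ (ψ x) v w = B₁ (ψ x) w v)
    (hnd : ∀ v, (∀ w, B₁ (ψ x) v w = 0) → v = 0)
    (v w c₂ : E) (c₁ : F)
    (h₁ : ∀ z, 2 * B₁ (ψ x) c₁ z = fderiv ℝ B₁ (ψ x) (fderiv ℝ ψ x v) (fderiv ℝ ψ x w) z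
      + fderiv ℝ B₁ (ψ x) (fderiv ℝ ψ x w) (fderiv ℝ ψ x v) z
      - fderiv ℝ B₁ (ψ x) z (fderiv ℝ ψ x v) (fderiv ℝ ψ x w))
    (h₂ : ∀ z, 2 * B₂ x c₂ z = fderiv ℝ B₂ x v w z + fderiv ℝ B₂ x w v z
      - fderiv ℝ B₂ x z v w) :
    fderiv ℝ ψ x c₂ = c₁ + fderiv ℝ (fderiv ℝ ψ) x v w := by
  have hψ' : DifferentiableAt ℝ (fderiv ℝ ψ) x :=
    (hψ.fderiv_right (m := 1) (by norm_num)).differentiableAt (by norm_num)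
  have hψ1 : DifferentiableAt ℝ ψ x := hψ.differentiableAt (by norm_num)
  have hs2 : ∀ a b, fderiv ℝ (fderiv ℝ ψ) x a b = fderiv ℝ (fderiv ℝ ψ) x b a := fun a b ↦
    (hψ.isSymmSndFDerivAt (by simp)).eq a b
  -- The pull-back identity holds near `x`, so it can be differentiated by the product rule.
  have key : ∀ t a b, fderiv ℝ B₂ x t a b =
      fderiv ℝ B₁ (ψ x) (fderiv ℝ ψ x t) (fderiv ℝ ψ x a) (fderiv ℝ ψ x b)
      + B₁ (ψ x) (fderiv ℝ (fderiv ℝ ψ) x t a) (fderiv ℝ ψ x b)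
      + B₁ (ψ x) (fderiv ℝ ψ x a) (fderiv ℝ (fderiv ℝ ψ) x t b) := by
    intro t a b
    have e : (fun y ↦ B₂ y a b) =ᶠ[𝓝 x]
        fun y ↦ B₁ (ψ y) (fderiv ℝ ψ y a) (fderiv ℝ ψ y b) := hB.mono fun y hy ↦ hy a b
    have d1 : HasFDerivAt (fun y ↦ B₂ y a b) _ x :=
      (hB₂.hasFDerivAt.clm_apply (hasFDerivAt_const a x)).clm_apply (hasFDerivAt_const b x)
    have d2 : HasFDerivAt (fun y ↦ B₁ (ψ y) (fderiv ℝ ψ y a) (fderiv ℝ ψ y b)) _ x :=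
      ((hB₁.hasFDerivAt.comp x hψ1.hasFDerivAt).clm_apply
        (hψ'.hasFDerivAt.clm_apply (hasFDerivAt_const a x))).clm_apply
        (hψ'.hasFDerivAt.clm_apply (hasFDerivAt_const b x))
    have := e.fderiv_eq (𝕜 := ℝ)
    rw [d1.fderiv, d2.fderiv] at this
    have := DFunLike.congr_fun this t
    simp at this
    linarith
  -- By nondegeneracy it suffices to pair with all vectors, and by surjectivity these are of the
  -- form `dψ z`. Of the six terms with `D²ψ` in the Koszul combination, symmetry of `D²ψ` and `B₁`
  -- cancels four and leaves `2 B₁(D²ψ(v, w), dψ z)`.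
  rw [← sub_eq_zero]
  refine hnd _ fun z' ↦ ?_
  obtain ⟨z, rfl⟩ := hsurj z'
  have e1 := h₁ (fderiv ℝ ψ x z)
  have e2 := h₂ z
  rw [hB.self_of_nhds, key, key, key, hs2 w v, hs2 z v, hs2 z w] at e2
  simp only [map_sub, map_add, sub_apply, add_apply]
  have s1 := hsymm (fderiv ℝ ψ x w) (fderiv ℝ (fderiv ℝ ψ) x v z)
  have s2 := hsymm (fderiv ℝ ψ x v) (fderiv ℝ (fderiv ℝ ψ) x w z)
  linarith

/-! ### The metric as a bilinear form, and invariance of the coordinate Laplacian -/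

section MetricForm

variable {n : ℕ}

/-- `∑ᵢⱼ Gᵢⱼ (Jᵀ H J)ᵢⱼ = ∑ᵢⱼ (J G Jᵀ)ᵢⱼ Hᵢⱼ`. -/
theorem sum_mul_conj (G H J : Matrix (Fin n) (Fin n) ℝ) :
    ∑ i, ∑ j, G i j * (J.transpose * H * J) i j
      = ∑ i, ∑ j, (J * G * J.transpose) i j * H i j := by
  have h : ∀ A B : Matrix (Fin n) (Fin n) ℝ,
      ∑ i, ∑ j, A i j * B i j = (A * B.transpose).trace := fun A B ↦ by
    simp [Matrix.trace, Matrix.mul_apply]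
  rw [h, h, Matrix.transpose_mul, Matrix.transpose_mul, Matrix.transpose_transpose,
    ← mul_assoc, ← mul_assoc, Matrix.trace_mul_comm]
  simp only [mul_assoc]

/-- All tangent spaces are the same space `ℝⁿ` by definition, but their inner products depend on the
base point, so an equality of base points has to be transported explicitly. -/
theorem inner_tangent_congr {M : Type*} [MetricSpace M]
    [ChartedSpace (EuclideanSpace ℝ (Fin n)) M]
    [RiemannianBundle (fun x : M => TangentSpace (𝓡 n) x)] {p q : M} (h : p = q)
    (a b : EuclideanSpace ℝ (Fin n)) :
    inner (E := TangentSpace (𝓡 n) p) ℝ a b = inner (E := TangentSpace (𝓡 n) q) ℝ a b := by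
  subst h
  rfl

/-- The linear combination `∑ᵢⱼ Gᵢⱼ Tᵢⱼ`. -/
def linComb {F : Type*} [NormedAddCommGroup F] [NormedSpace ℝ F]
    (T : Fin n → Fin n → F) (G : Matrix (Fin n) (Fin n) ℝ) : F :=
  ∑ i, ∑ j, G i j • T i j

theorem differentiableAt_linComb {E F : Type*} [NormedAddCommGroup E] [NormedSpace ℝ E]
    [NormedAddCommGroup F] [NormedSpace ℝ F] (T : Fin n → Fin n → F)
    {G : E → Matrix (Fin n) (Fin n) ℝ} {x : E}
    (hG : ∀ i j, DifferentiableAt ℝ (fun y ↦ G y i j) x) :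
    DifferentiableAt ℝ (fun y ↦ linComb T (G y)) x :=
  DifferentiableAt.fun_sum fun i _ ↦ DifferentiableAt.fun_sum fun j _ ↦ (hG i j).smul_const _

set_option synthInstance.maxHeartbeats 400000 in
/-- The bilinear form with matrix `G` in the standard basis. -/
def formOf (G : Matrix (Fin n) (Fin n) ℝ) :
    EuclideanSpace ℝ (Fin n) →L[ℝ] EuclideanSpace ℝ (Fin n) →L[ℝ] ℝ :=
  linComb (fun i j ↦ (EuclideanSpace.proj i : EuclideanSpace ℝ (Fin n) →L[ℝ] ℝ).smulRight
      (EuclideanSpace.proj j : EuclideanSpace ℝ (Fin n) →L[ℝ] ℝ)) G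

theorem formOf_apply (G : Matrix (Fin n) (Fin n) ℝ) (v w : EuclideanSpace ℝ (Fin n)) :
    formOf G v w = ∑ i, ∑ j, G i j * (v i * w j) := by
  simp [formOf, linComb]

theorem formOf_stdVec (G : Matrix (Fin n) (Fin n) ℝ) (i j : Fin n) :
    formOf G (stdVec i) (stdVec j) = G i j := by
  simp [formOf_apply]

theorem bilin_expand {F : Type*} [NormedAddCommGroup F] [NormedSpace ℝ F]
    (B : EuclideanSpace ℝ (Fin n) →L[ℝ] EuclideanSpace ℝ (Fin n) →L[ℝ] F)
    (v w : EuclideanSpace ℝ (Fin n)) :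
    B v w = ∑ i, ∑ j, (v i * w j) • B (stdVec i) (stdVec j) := by
  conv_lhs => rw [← sum_smul_stdVec v, ← sum_smul_stdVec w]
  simp only [map_sum, map_smul, sum_apply, smul_apply, Finset.smul_sum, smul_smul]
  rw [Finset.sum_comm]
  simp only [mul_comm]

theorem formOf_symm {G : Matrix (Fin n) (Fin n) ℝ} (hG : G.IsSymm)
    (v w : EuclideanSpace ℝ (Fin n)) : formOf G v w = formOf G w v := by
  rw [formOf_apply, formOf_apply, Finset.sum_comm]
  refine Finset.sum_congr rfl fun i _ ↦ Finset.sum_congr rfl fun j _ ↦ ?_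
  rw [hG.apply i j, mul_comm (v j)]

theorem formOf_nondegenerate {G : Matrix (Fin n) (Fin n) ℝ} (hG : G.PosDef)
    (v : EuclideanSpace ℝ (Fin n)) (h : ∀ w, formOf G v w = 0) : v = 0 := by
  by_contra hv
  have h1 : v.ofLp ≠ 0 := fun h0 ↦ hv (by ext i; simp [h0])
  have h2 := hG.dotProduct_mulVec_pos h1
  have h3 := h v
  rw [formOf_apply] at h3
  refine h2.ne' ?_
  rw [← h3]
  simp only [dotProduct, Matrix.mulVec, Finset.mul_sum, star_trivial]
  exact Finset.sum_congr rfl fun i _ ↦ Finset.sum_congr rfl fun j _ ↦ by ring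

set_option synthInstance.maxHeartbeats 400000 in
theorem differentiableAt_formOf {G : EuclideanSpace ℝ (Fin n) → Matrix (Fin n) (Fin n) ℝ}
    {x : EuclideanSpace ℝ (Fin n)} (hG : ∀ i j, DifferentiableAt ℝ (fun y ↦ G y i j) x) :
    DifferentiableAt ℝ (fun y ↦ formOf (G y)) x :=
  differentiableAt_linComb _ hG

set_option synthInstance.maxHeartbeats 400000 in
theorem fderiv_formOf {G : EuclideanSpace ℝ (Fin n) → Matrix (Fin n) (Fin n) ℝ}
    {x : EuclideanSpace ℝ (Fin n)} (hG : ∀ i j, DifferentiableAt ℝ (fun y ↦ G y i j) x)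
    (l i j : Fin n) :
    fderiv ℝ (fun y ↦ formOf (G y)) x (stdVec l) (stdVec i) (stdVec j)
      = partialD l (fun y ↦ G y i j) x := by
  have h := (((differentiableAt_formOf hG).hasFDerivAt.clm_apply
    (hasFDerivAt_const (stdVec i) x)).clm_apply (hasFDerivAt_const (stdVec j) x)).fderiv
  simp only [formOf_stdVec] at h
  rw [partialD, h]
  simp

variable {M : Type*} [MetricSpace M] [ChartedSpace (EuclideanSpace ℝ (Fin n)) M]
  [RiemannianBundle (fun x : M => TangentSpace (𝓡 n) x)]

theorem metricCoeff_congr {Φ Φ' : EuclideanSpace ℝ (Fin n) → M}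
    {x : EuclideanSpace ℝ (Fin n)} (h : Φ =ᶠ[𝓝 x] Φ') : metricCoeff Φ x = metricCoeff Φ' x := by
  ext i j
  have h1 : (mfderiv (𝓡 n) (𝓡 n) Φ x : EuclideanSpace ℝ (Fin n) →L[ℝ] EuclideanSpace ℝ (Fin n))
      = mfderiv (𝓡 n) (𝓡 n) Φ' x := h.mfderiv_eq
  have h2 := fun v w ↦ congrArg₂ (inner (E := TangentSpace (𝓡 n) (Φ x)) ℝ)
    (DFunLike.congr_fun h1 v) (DFunLike.congr_fun h1 w)
  exact (h2 _ _).trans (inner_tangent_congr h.self_of_nhds _ _)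

/-- The Christoffel symbols as a bilinear map with values in vectors. -/
def christoffelVec (Φ : EuclideanSpace ℝ (Fin n) → M) (x v w : EuclideanSpace ℝ (Fin n)) :
    EuclideanSpace ℝ (Fin n) :=
  ∑ i, ∑ j, (v i * w j) • WithLp.toLp 2 fun k ↦ christoffel Φ x k i j

theorem christoffelVec_stdVec (Φ : EuclideanSpace ℝ (Fin n) → M)
    (x : EuclideanSpace ℝ (Fin n)) (i j : Fin n) :
    christoffelVec Φ x (stdVec i) (stdVec j) = WithLp.toLp 2 fun k ↦ christoffel Φ x k i j := by
  simp [christoffelVec]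

theorem metricCoeff_isSymm (Φ : EuclideanSpace ℝ (Fin n) → M) (x : EuclideanSpace ℝ (Fin n)) :
    (metricCoeff Φ x).IsSymm := by
  ext i j
  simp only [metricCoeff, Matrix.transpose_apply, Matrix.of_apply]
  exact real_inner_comm _ _

-- Pairing with `g` cancels the factor `g⁻¹` in the definition of `Γ`; this gives the formula on
-- basis vectors, and trilinearity gives the rest. It is the index-free input for
-- `koszul_transform`.
set_option synthInstance.maxHeartbeats 400000 in
theorem koszul_christoffel {Φ : EuclideanSpace ℝ (Fin n) → M} {x : EuclideanSpace ℝ (Fin n)}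
    (hG : ∀ i j, DifferentiableAt ℝ (fun y ↦ metricCoeff Φ y i j) x)
    (hpos : (metricCoeff Φ x).PosDef) (v w z : EuclideanSpace ℝ (Fin n)) :
    2 * formOf (metricCoeff Φ x) (christoffelVec Φ x v w) z =
      fderiv ℝ (fun y ↦ formOf (metricCoeff Φ y)) x v w z
      + fderiv ℝ (fun y ↦ formOf (metricCoeff Φ y)) x w v z
      - fderiv ℝ (fun y ↦ formOf (metricCoeff Φ y)) x z v w := by
  set D := fderiv ℝ (fun y ↦ formOf (metricCoeff Φ y)) x with hD
  set g := metricCoeff Φ x with hg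
  have hbase : ∀ i j l, 2 * formOf g (WithLp.toLp 2 fun k ↦ christoffel Φ x k i j) (stdVec l)
      = D (stdVec i) (stdVec j) (stdVec l) + D (stdVec j) (stdVec i) (stdVec l)
        - D (stdVec l) (stdVec i) (stdVec j) := by
    intro i j l
    set c : Fin n → ℝ := fun m ↦ partialD i (fun y => metricCoeff Φ y j m) x
        + partialD j (fun y => metricCoeff Φ y i m) x
        - partialD m (fun y => metricCoeff Φ y i j) x with hc
    have h1 : (fun k ↦ christoffel Φ x k i j) = (1 / 2 : ℝ) • (g⁻¹).mulVec c := by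
      ext k
      simp [christoffel, Matrix.mulVec, dotProduct, hc, hg]
    have h2 : formOf g (WithLp.toLp 2 fun k ↦ christoffel Φ x k i j) (stdVec l)
        = (g.mulVec fun k ↦ christoffel Φ x k i j) l := by
      rw [formOf_apply]
      simp only [Matrix.mulVec, dotProduct]
      refine Finset.sum_congr rfl fun k _ ↦ ?_
      have := (metricCoeff_isSymm Φ x).apply l k
      simp [hg, this]
    have hu : IsUnit g.det := (Matrix.isUnit_iff_isUnit_det g).1 hpos.isUnit
    rw [h2, h1, Matrix.mulVec_smul, Matrix.mulVec_mulVec, Matrix.mul_nonsing_inv _ hu,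
      Matrix.one_mulVec, hD, fderiv_formOf hG, fderiv_formOf hG, fderiv_formOf hG]
    simp [hc]
  have hij : ∀ i j z, 2 * formOf g (WithLp.toLp 2 fun k ↦ christoffel Φ x k i j) z
      = D (stdVec i) (stdVec j) z + D (stdVec j) (stdVec i) z - D z (stdVec i) (stdVec j) := by
    intro i j z
    rw [← sum_smul_stdVec z]
    simp only [map_sum, map_smul, sum_apply, smul_apply, smul_eq_mul, Finset.mul_sum,
      ← Finset.sum_add_distrib, ← Finset.sum_sub_distrib]
    refine Finset.sum_congr rfl fun l _ ↦ ?_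
    linear_combination (z l) * hbase i j l
  have e1 : D v w z = ∑ i, ∑ j, (v i * w j) * D (stdVec i) (stdVec j) z := by
    rw [bilin_expand D v w]
    simp [sum_apply]
  have e2 : D w v z = ∑ i, ∑ j, (v i * w j) * D (stdVec j) (stdVec i) z := by
    rw [bilin_expand D w v, Finset.sum_comm]
    simp [sum_apply, mul_comm]
  have e3 : D z v w = ∑ i, ∑ j, (v i * w j) * D z (stdVec i) (stdVec j) := by
    rw [bilin_expand (D z) v w]
    simp
  rw [e1, e2, e3, christoffelVec]
  simp only [map_sum, map_smul, sum_apply, smul_apply, smul_eq_mul, Finset.mul_sum,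
      ← Finset.sum_add_distrib, ← Finset.sum_sub_distrib]
  refine Finset.sum_congr rfl fun i _ ↦ Finset.sum_congr rfl fun j _ ↦ ?_
  linear_combination (v i * w j) * hij i j z

/-- The Laplacian is the trace of the covariant Hessian. -/
theorem laplaceIn_apply (Φ : EuclideanSpace ℝ (Fin n) → M) {u : EuclideanSpace ℝ (Fin n) → ℝ}
    {x : EuclideanSpace ℝ (Fin n)} (hu : ContDiffAt ℝ 2 u x) :
    (laplaceIn Φ).apply u x = ∑ i, ∑ j, (metricCoeff Φ x)⁻¹ i j *
      (fderiv ℝ (fderiv ℝ u) x (stdVec i) (stdVec j)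
        - fderiv ℝ u x (christoffelVec Φ x (stdVec i) (stdVec j))) := by
  rw [LinOp.apply_eq _ hu]
  have : (laplaceIn Φ).b x = -∑ i, ∑ j, (metricCoeff Φ x)⁻¹ i j •
      christoffelVec Φ x (stdVec i) (stdVec j) := by
    ext k
    simp [laplaceIn, christoffelVec_stdVec]
  rw [this]
  simp [laplaceIn, mul_add, Finset.sum_add_distrib, sub_eq_add_neg]

theorem formOf_metricCoeff (Φ : EuclideanSpace ℝ (Fin n) → M)
    (x v w : EuclideanSpace ℝ (Fin n)) :
    formOf (metricCoeff Φ x) v w =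
      inner ℝ (mfderiv (𝓡 n) (𝓡 n) Φ x v) (mfderiv (𝓡 n) (𝓡 n) Φ x w) := by
  have h : ∀ v : EuclideanSpace ℝ (Fin n), mfderiv (𝓡 n) (𝓡 n) Φ x v
      = ∑ i, v i • mfderiv (𝓡 n) (𝓡 n) Φ x (stdVec i) := by
    intro v
    conv_lhs => rw [← sum_smul_stdVec v]
    erw [map_sum]
    exact Finset.sum_congr rfl fun i _ ↦ map_smul (mfderiv (𝓡 n) (𝓡 n) Φ x) (v i) (stdVec i)
  rw [formOf_apply, h v, h w]
  simp only [sum_inner, inner_sum, real_inner_smul_left, real_inner_smul_right]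
  rw [Finset.sum_comm]
  refine Finset.sum_congr rfl fun i _ ↦ Finset.sum_congr rfl fun j _ ↦ ?_
  rw [metricCoeff, Matrix.of_apply]
  ring

theorem metricCoeff_posDef {Φ : EuclideanSpace ℝ (Fin n) → M} {x : EuclideanSpace ℝ (Fin n)}
    (h : Function.Injective (mfderiv (𝓡 n) (𝓡 n) Φ x)) : (metricCoeff Φ x).PosDef := by
  refine Matrix.PosDef.of_dotProduct_mulVec_pos ?_ fun v hv ↦ ?_
  · rw [Matrix.IsHermitian, Matrix.conjTranspose_eq_transpose_of_trivial]
    exact metricCoeff_isSymm Φ x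
  · have e : star v ⬝ᵥ (metricCoeff Φ x).mulVec v
        = formOf (metricCoeff Φ x) (WithLp.toLp 2 v) (WithLp.toLp 2 v) := by
      rw [formOf_apply]
      simp only [dotProduct, Matrix.mulVec, Finset.mul_sum, star_trivial]
      exact Finset.sum_congr rfl fun i _ ↦ Finset.sum_congr rfl fun j _ ↦ by ring
    rw [e, formOf_metricCoeff, real_inner_self_pos]
    intro h0
    have : (WithLp.toLp 2 v : EuclideanSpace ℝ (Fin n)) = 0 :=
      h (h0.trans (map_zero (mfderiv (𝓡 n) (𝓡 n) Φ x)).symm)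
    exact hv (by ext i; simpa using congrArg (fun y : EuclideanSpace ℝ (Fin n) ↦ y i) this)

set_option synthInstance.maxHeartbeats 400000 in
/-- Invariance of the Laplacian under a change of coordinates. -/
theorem laplaceIn_comp {Φ₁ Φ₂ : EuclideanSpace ℝ (Fin n) → M}
    {ψ : EuclideanSpace ℝ (Fin n) → EuclideanSpace ℝ (Fin n)} {x : EuclideanSpace ℝ (Fin n)}
    (hψ : ContDiffAt ℝ 2 ψ x) (hJ : Function.Bijective (fderiv ℝ ψ x))
    (hΦ : Φ₂ =ᶠ[𝓝 x] Φ₁ ∘ ψ)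
    (hΦ₁ : ∀ᶠ y in 𝓝 (ψ x), MDifferentiableAt (𝓡 n) (𝓡 n) Φ₁ y)
    (hG₁ : ∀ i j, DifferentiableAt ℝ (fun y ↦ metricCoeff Φ₁ y i j) (ψ x))
    (hG₂ : ∀ i j, DifferentiableAt ℝ (fun y ↦ metricCoeff Φ₂ y i j) x)
    (hpos₁ : (metricCoeff Φ₁ (ψ x)).PosDef) (hpos₂ : (metricCoeff Φ₂ x).PosDef)
    {u : EuclideanSpace ℝ (Fin n) → ℝ} (hu : ContDiffAt ℝ 2 u (ψ x)) :
    (laplaceIn Φ₂).apply (u ∘ ψ) x = (laplaceIn Φ₁).apply u (ψ x) := by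
  have hB : ∀ᶠ y in 𝓝 x, ∀ v w, formOf (metricCoeff Φ₂ y) v w
      = formOf (metricCoeff Φ₁ (ψ y)) (fderiv ℝ ψ y v) (fderiv ℝ ψ y w) := by
    have e1 : ∀ᶠ y in 𝓝 x, DifferentiableAt ℝ ψ y :=
      (hψ.eventually (by simp)).mono fun y hy ↦ hy.differentiableAt (by norm_num)
    filter_upwards [e1, hψ.continuousAt.eventually hΦ₁, hΦ.eventuallyEq_nhds] with y h1 h2 h3 v w
    have h4 := mfderiv_comp y h2 h1.mdifferentiableAt
    rw [metricCoeff_congr h3, formOf_metricCoeff, formOf_metricCoeff, h4, mfderiv_eq_fderiv]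
    rfl
  have hΓ : ∀ v w, fderiv ℝ ψ x (christoffelVec Φ₂ x v w)
      = christoffelVec Φ₁ (ψ x) (fderiv ℝ ψ x v) (fderiv ℝ ψ x w)
        + fderiv ℝ (fderiv ℝ ψ) x v w := fun v w ↦
    koszul_transform hψ hJ.surjective (differentiableAt_formOf hG₁) hB (differentiableAt_formOf hG₂)
      (formOf_symm (metricCoeff_isSymm _ _)) (formOf_nondegenerate hpos₁) v w _ _
      (koszul_christoffel hG₁ hpos₁ _ _) (koszul_christoffel hG₂ hpos₂ v w)
  rw [laplaceIn_apply _ hu, laplaceIn_apply _ (hu.comp x hψ)]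
  set H : Matrix (Fin n) (Fin n) ℝ := Matrix.of fun k l ↦
    fderiv ℝ (fderiv ℝ u) (ψ x) (stdVec k) (stdVec l)
      - fderiv ℝ u (ψ x) (christoffelVec Φ₁ (ψ x) (stdVec k) (stdVec l)) with hH
  set J : Matrix (Fin n) (Fin n) ℝ := Matrix.of fun k i ↦ fderiv ℝ ψ x (stdVec i) k with hJm
  have hHess : ∀ i j, fderiv ℝ (fderiv ℝ (u ∘ ψ)) x (stdVec i) (stdVec j)
      - fderiv ℝ (u ∘ ψ) x (christoffelVec Φ₂ x (stdVec i) (stdVec j))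
      = (J.transpose * H * J) i j := by
    intro i j
    rw [fderiv_fderiv_comp hψ hu, fderiv_comp x (hu.differentiableAt (by norm_num))
      (hψ.differentiableAt (by norm_num)), ContinuousLinearMap.comp_apply, hΓ, map_add,
      bilin_expand (fderiv ℝ (fderiv ℝ u) (ψ x)), christoffelVec]
    simp only [Matrix.mul_apply, Matrix.transpose_apply, hH, hJm, Matrix.of_apply,
      christoffelVec_stdVec, map_sum, map_smul, smul_eq_mul, Finset.sum_mul]
    -- The `D²ψ` term of the chain rule cancels against the inhomogeneous term of the transformed
    -- Christoffel symbols, so the covariant Hessian transforms as a tensor.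
    rw [add_sub_add_right_eq_sub, ← Finset.sum_sub_distrib]
    simp only [← Finset.sum_sub_distrib]
    rw [Finset.sum_comm]
    refine Finset.sum_congr rfl fun k _ ↦ Finset.sum_congr rfl fun l _ ↦ ?_
    ring
  have hg : metricCoeff Φ₂ x = J.transpose * metricCoeff Φ₁ (ψ x) * J := by
    ext i j
    rw [← formOf_stdVec (metricCoeff Φ₂ x), hB.self_of_nhds, formOf_apply]
    simp only [Matrix.mul_apply, Matrix.transpose_apply, hJm, Matrix.of_apply, Finset.sum_mul]
    rw [Finset.sum_comm]
    refine Finset.sum_congr rfl fun k _ ↦ Finset.sum_congr rfl fun l _ ↦ ?_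
    ring
  -- `J` is a factor of the invertible matrix `metricCoeff Φ₂ x = Jᵀ g₁ J`.
  have hdet : IsUnit J.det := by
    have h1 := (Matrix.isUnit_iff_isUnit_det _).1 hpos₂.isUnit
    rw [hg, Matrix.det_mul] at h1
    exact isUnit_of_mul_isUnit_right h1
  have hinv : J * (metricCoeff Φ₂ x)⁻¹ * J.transpose = (metricCoeff Φ₁ (ψ x))⁻¹ := by
    have hdet' : IsUnit J.transpose.det := by rwa [Matrix.det_transpose]
    rw [hg, Matrix.mul_inv_rev, Matrix.mul_inv_rev, ← mul_assoc, ← mul_assoc,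
      Matrix.mul_nonsing_inv _ hdet, one_mul, mul_assoc, Matrix.nonsing_inv_mul _ hdet', mul_one]
  simp only [hHess]
  rw [sum_mul_conj, hinv]
  simp [hH]

end MetricForm

theorem two_le_infty : (2 : WithTop ℕ∞) ≤ ∞ :=
  WithTop.coe_le_coe.2 (le_top : (2 : ℕ∞) ≤ ⊤)

/-! ### From the Laplacian in the preferred chart to an arbitrary parametrization -/

section LaplacianInvariance

variable {n : ℕ} {M : Type*} [MetricSpace M] [ChartedSpace (EuclideanSpace ℝ (Fin n)) M]
  [IsManifold (𝓡 n) ∞ M]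

/-- The coordinate vector field along `Φ` must be smooth as a map into the tangent bundle, since
smoothness of the Riemannian metric is expressed there. -/
theorem contMDiffAt_mfderiv_const_vec {Φ : EuclideanSpace ℝ (Fin n) → M}
    {x : EuclideanSpace ℝ (Fin n)} (h : ContMDiffAt (𝓡 n) (𝓡 n) ∞ Φ x)
    (a : EuclideanSpace ℝ (Fin n)) :
    ContMDiffAt (𝓡 n) (𝓡 n).tangent ∞
      (fun y ↦ (⟨Φ y, mfderiv (𝓡 n) (𝓡 n) Φ y a⟩ : TangentBundle (𝓡 n) M)) x := by
  have A := h.mfderiv_const (m := ∞) (by simp)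
  have hv : ContMDiffAt (𝓡 n) (𝓡 n).tangent ∞
      (fun y : EuclideanSpace ℝ (Fin n) ↦
        (⟨y, a⟩ : TangentBundle (𝓡 n) (EuclideanSpace ℝ (Fin n)))) x := by
    rw [contMDiffAt_totalSpace]
    refine ⟨contMDiffAt_id, ?_⟩
    simpa using contMDiffAt_const
  exact ContMDiffAt.clm_apply_of_inCoordinates A hv h

variable [RiemannianBundle (fun x : M => TangentSpace (𝓡 n) x)]
  [IsContMDiffRiemannianBundle (𝓡 n) ∞ (EuclideanSpace ℝ (Fin n))
      (fun x : M => TangentSpace (𝓡 n) x)]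

theorem differentiableAt_metricCoeff {Φ : EuclideanSpace ℝ (Fin n) → M}
    {x : EuclideanSpace ℝ (Fin n)} (h : ContMDiffAt (𝓡 n) (𝓡 n) ∞ Φ x) (i j : Fin n) :
    DifferentiableAt ℝ (fun y ↦ metricCoeff Φ y i j) x :=
  ((contMDiffAt_mfderiv_const_vec h (stdVec i)).inner_bundle
    (contMDiffAt_mfderiv_const_vec h (stdVec j))).contDiffAt.differentiableAt (by simp)

/-- Near `x`, `Φ` is the inverse of the preferred chart composed with the transition map `ψ`, so
this is an instance of `laplaceIn_comp`. -/
theorem laplacian_eq_laplaceIn {Φ : EuclideanSpace ℝ (Fin n) → M}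
    {x : EuclideanSpace ℝ (Fin n)} (h : IsLocalDiffeomorphAt (𝓡 n) (𝓡 n) ∞ Φ x)
    {f : M → ℝ} (hf : ContMDiffAt (𝓡 n) 𝓘(ℝ, ℝ) 2 f (Φ x)) :
    laplacian (n := n) f (Φ x) = (laplaceIn Φ).apply (f ∘ Φ) x := by
  have hΦ : ContMDiffAt (𝓡 n) (𝓡 n) ∞ Φ x := h.contMDiffAt
  set χ := extChartAt (𝓡 n) (Φ x) with hχ
  have hχs : χ.source ∈ 𝓝 (Φ x) := extChartAt_source_mem_nhds _
  have hχt : χ.target ∈ 𝓝 (χ (Φ x)) := extChartAt_target_mem_nhds _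
  have hsymm : ∀ y ∈ χ.target, ContMDiffAt (𝓡 n) (𝓡 n) ∞ χ.symm y := fun y hy ↦
    (contMDiffOn_extChartAt_symm (Φ x)).contMDiffAt
      ((isOpen_extChartAt_target (Φ x)).mem_nhds hy)
  set ψ := χ ∘ Φ with hψdef
  have hψ : ContDiffAt ℝ ∞ ψ x := by
    rw [← contMDiffAt_iff_contDiffAt]
    exact (contMDiffAt_extChartAt (n := ∞)).comp x hΦ
  have hψ2 : ContDiffAt ℝ 2 ψ x := hψ.of_le two_le_infty
  have hx : ψ x ∈ χ.target := mem_of_mem_nhds hχt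
  have hcomp : Φ =ᶠ[𝓝 x] χ.symm ∘ ψ := by
    filter_upwards [hΦ.continuousAt.preimage_mem_nhds hχs] with y hy
    exact (χ.left_inv hy).symm
  have hΦb : Function.Bijective (mfderiv (𝓡 n) (𝓡 n) Φ x) :=
    (h.mfderivToContinuousLinearEquiv (by simp)).bijective
  have hd : (mfderiv (𝓡 n) (𝓡 n) Φ x : EuclideanSpace ℝ (Fin n) → EuclideanSpace ℝ (Fin n))
      = (mfderiv (𝓡 n) (𝓡 n) χ.symm (ψ x) :
          EuclideanSpace ℝ (Fin n) → EuclideanSpace ℝ (Fin n)) ∘ fderiv ℝ ψ x := by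
    have h1 := mfderiv_comp x ((hsymm _ hx).mdifferentiableAt (by simp))
      (hψ.differentiableAt (by simp)).mdifferentiableAt
    have h2 : (mfderiv (𝓡 n) (𝓡 n) Φ x : EuclideanSpace ℝ (Fin n) →L[ℝ] EuclideanSpace ℝ (Fin n))
      = mfderiv (𝓡 n) (𝓡 n) (χ.symm ∘ ψ) x := hcomp.mfderiv_eq
    funext v
    refine (DFunLike.congr_fun h2 v).trans ?_
    rw [h1, mfderiv_eq_fderiv]
    rfl
  have hΦb' := hΦb
  erw [hd] at hΦb'
  -- The bijection `dΦ` factors as `dχ⁻¹ ∘ dψ`: the inner factor is injective, the outer one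
  -- surjective, and in equal finite dimensions both are bijective.
  have hJ : Function.Bijective (fderiv ℝ ψ x) := by
    have hi : Function.Injective (fderiv ℝ ψ x) := hΦb'.injective.of_comp
    exact ⟨hi, LinearMap.injective_iff_surjective (f := (fderiv ℝ ψ x).toLinearMap).1 hi⟩
  have hinj : Function.Injective (mfderiv (𝓡 n) (𝓡 n) χ.symm (ψ x)) := by
    have hs : Function.Surjective (mfderiv (𝓡 n) (𝓡 n) χ.symm (ψ x)) := hΦb'.surjective.of_comp
    have hT : ∀ T : EuclideanSpace ℝ (Fin n) →L[ℝ] EuclideanSpace ℝ (Fin n),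
        Function.Surjective T → Function.Injective T := fun T h ↦
      LinearMap.injective_iff_surjective (f := T.toLinearMap).2 h
    exact hT _ hs
  have hu : ContDiffAt ℝ 2 (f ∘ χ.symm) (ψ x) := by
    rw [← contMDiffAt_iff_contDiffAt]
    refine ContMDiffAt.comp (ψ x) ?_ ((hsymm _ hx).of_le two_le_infty)
    rwa [← show Φ x = χ.symm (ψ x) from hcomp.self_of_nhds]
  have key := laplaceIn_comp hψ2 hJ hcomp
    (by filter_upwards [hχt] with y hy using (hsymm y hy).mdifferentiableAt (by simp))
    (differentiableAt_metricCoeff (hsymm _ hx)) (differentiableAt_metricCoeff hΦ)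
    (metricCoeff_posDef hinj) (metricCoeff_posDef hΦb.injective) hu
  rw [laplacian, ← hχ]
  refine key.symm.trans (LinOp.apply_congr _ ?_)
  filter_upwards [hcomp] with y hy
  simp only [Function.comp_apply] at hy ⊢
  rw [← hy]

end LaplacianInvariance

/-! ### Averaging coefficients over signed permutations -/

section Averaging

open LinOp

variable {n : ℕ}

theorem rotMatrix_mulVec (Q : EuclideanSpace ℝ (Fin n) ≃ₗᵢ[ℝ] EuclideanSpace ℝ (Fin n))
    (v : EuclideanSpace ℝ (Fin n)) : (rotMatrix Q).mulVec v.ofLp = (Q v).ofLp := by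
  conv_rhs => rw [← sum_smul_stdVec v]
  ext k
  simp [Matrix.mulVec, dotProduct, rotMatrix, mul_comm]

theorem rotMatrix_trans (P Q : EuclideanSpace ℝ (Fin n) ≃ₗᵢ[ℝ] EuclideanSpace ℝ (Fin n)) :
    rotMatrix (P.trans Q) = rotMatrix Q * rotMatrix P := by
  ext k i
  have := congrFun (rotMatrix_mulVec Q (P (stdVec i))) k
  simpa [Matrix.mulVec, dotProduct, rotMatrix, Matrix.mul_apply] using this.symm

theorem rotMatrix_mul_transpose
    (Q : EuclideanSpace ℝ (Fin n) ≃ₗᵢ[ℝ] EuclideanSpace ℝ (Fin n)) :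
    rotMatrix Q * (rotMatrix Q).transpose = 1 := by
  rw [mul_eq_one_comm]
  ext i j
  have h := Q.inner_map_map (stdVec i) (stdVec j)
  rw [PiLp.inner_apply, PiLp.inner_apply] at h
  simp [Matrix.mul_apply, rotMatrix, Matrix.one_apply] at h ⊢
  simpa [mul_comm, eq_comm] using h

theorem rotMatrix_symm (Q : EuclideanSpace ℝ (Fin n) ≃ₗᵢ[ℝ] EuclideanSpace ℝ (Fin n)) :
    rotMatrix Q.symm = (rotMatrix Q).transpose := by
  have h : rotMatrix Q.symm * rotMatrix Q = 1 := by
    rw [← rotMatrix_trans]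
    ext k i
    simp [rotMatrix, Matrix.one_apply]
  calc rotMatrix Q.symm = rotMatrix Q.symm * (rotMatrix Q * (rotMatrix Q).transpose) := by
        rw [rotMatrix_mul_transpose, mul_one]
    _ = _ := by rw [← mul_assoc, h, one_mul]

/-- There is a linear isometry carrying any vector to any other one of the same length. -/
theorem exists_isometry_map_eq {v w : EuclideanSpace ℝ (Fin n)} (h : ‖v‖ = ‖w‖) :
    ∃ Q : EuclideanSpace ℝ (Fin n) ≃ₗᵢ[ℝ] EuclideanSpace ℝ (Fin n), Q v = w :=
  ⟨_, Submodule.reflection_sub h⟩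

/-- The signed permutation `v ↦ (sᵢ v_{σ i})ᵢ`. -/
def signedPerm (s : Fin n → ℤˣ) (σ : Equiv.Perm (Fin n)) :
    EuclideanSpace ℝ (Fin n) ≃ₗᵢ[ℝ] EuclideanSpace ℝ (Fin n) :=
  (LinearIsometryEquiv.piLpCongrLeft 2 ℝ ℝ σ.symm).trans
    (LinearIsometryEquiv.piLpCongrRight 2 fun i ↦
      if s i = 1 then LinearIsometryEquiv.refl ℝ ℝ else LinearIsometryEquiv.neg ℝ)

theorem signedPerm_apply (s : Fin n → ℤˣ) (σ : Equiv.Perm (Fin n))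
    (v : EuclideanSpace ℝ (Fin n)) (i : Fin n) :
    signedPerm s σ v i = ((s i : ℤ) : ℝ) * v (σ i) := by
  rcases Int.units_eq_one_or (s i) with h | h <;>
    simp [signedPerm, h, LinearIsometryEquiv.piLpCongrLeft_apply, Equiv.piCongrLeft']

/-- The signed permutations fixing the `k`-th basis vector. -/
def fixingPerms (k : Fin n) : Finset ((Fin n → ℤˣ) × Equiv.Perm (Fin n)) :=
  Finset.univ.filter fun p ↦ p.1 k = 1 ∧ p.2 k = k

theorem fixingPerms_card_pos (k : Fin n) : 0 < (fixingPerms k).card :=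
  Finset.card_pos.2 ⟨(1, 1), by simp [fixingPerms]⟩

theorem signedPerm_stdVec {k : Fin n} {p : (Fin n → ℤˣ) × Equiv.Perm (Fin n)}
    (hp : p ∈ fixingPerms k) : signedPerm p.1 p.2 (stdVec k) = stdVec k := by
  simp only [fixingPerms, Finset.mem_filter, Finset.mem_univ, true_and] at hp
  ext i
  rw [signedPerm_apply]
  by_cases hi : i = k
  · subst hi
    simp [hp.1, hp.2]
  · have : p.2 i ≠ k := fun h ↦ hi (p.2.injective (h.trans hp.2.symm))
    simp [hi, this]

/-- Flipping the `i`-th sign is an involution of `fixingPerms k`, because only the sign at `k` is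
prescribed. A quantity odd under the flip therefore sums to zero; this kills the off-diagonal
entries and the tangential part of vectors. -/
theorem sum_fixingPerms_of_neg {k i : Fin n} (hi : i ≠ k)
    {f : (Fin n → ℤˣ) × Equiv.Perm (Fin n) → ℝ}
    (hf : ∀ s σ, f (Function.update s i (-s i), σ) = -f (s, σ)) :
    ∑ p ∈ fixingPerms k, f p = 0 := by
  have h : ∑ p ∈ fixingPerms k, f p = ∑ p ∈ fixingPerms k, -f p := by
    refine Finset.sum_nbij' (fun p ↦ (Function.update p.1 i (-p.1 i), p.2))
      (fun p ↦ (Function.update p.1 i (-p.1 i), p.2)) ?_ ?_ ?_ ?_ ?_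
    · intro p hp
      simpa [fixingPerms, Function.update_of_ne hi.symm] using hp
    · intro p hp
      simpa [fixingPerms, Function.update_of_ne hi.symm] using hp
    · intro p _
      simp
    · intro p _
      simp
    · intro p _
      rw [hf, neg_neg]
  rw [Finset.sum_neg_distrib] at h
  linarith

theorem sum_fixingPerms_vec (k : Fin n) (b : Fin n → ℝ) (i : Fin n) :
    ∑ p ∈ fixingPerms k, ((p.1 i : ℤ) : ℝ) * b (p.2 i)
      = if i = k then (fixingPerms k).card * b k else 0 := by
  split_ifs with h
  · subst h
    rw [Finset.sum_congr rfl (g := fun _ ↦ b i), Finset.sum_const, nsmul_eq_mul]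
    intro p hp
    simp only [fixingPerms, Finset.mem_filter, Finset.mem_univ, true_and] at hp
    simp [hp.1, hp.2]
  · exact sum_fixingPerms_of_neg h fun s σ ↦ by simp

theorem sum_fixingPerms_offDiag (k : Fin n) (A : Matrix (Fin n) (Fin n) ℝ) {i j : Fin n}
    (hij : i ≠ j) :
    ∑ p ∈ fixingPerms k, ((p.1 i : ℤ) : ℝ) * ((p.1 j : ℤ) : ℝ) * A (p.2 i) (p.2 j) = 0 := by
  by_cases hi : i = k
  · have hj : j ≠ k := fun h ↦ hij (hi.trans h.symm)
    exact sum_fixingPerms_of_neg hj fun s σ ↦ by simp [Function.update_of_ne hij]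
  · exact sum_fixingPerms_of_neg hi fun s σ ↦ by simp [Function.update_of_ne hij.symm]

/-- Composition with the transposition of `i` and `j` is an involution of `fixingPerms k`, since it
fixes `k`. -/
theorem sum_fixingPerms_diag_eq (k : Fin n) (A : Matrix (Fin n) (Fin n) ℝ) {i j : Fin n}
    (hi : i ≠ k) (hj : j ≠ k) :
    ∑ p ∈ fixingPerms k, A (p.2 i) (p.2 i) = ∑ p ∈ fixingPerms k, A (p.2 j) (p.2 j) := by
  have hk : Equiv.swap i j k = k := Equiv.swap_apply_of_ne_of_ne hi.symm hj.symm
  refine Finset.sum_nbij' (fun p ↦ (p.1, p.2 * Equiv.swap i j))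
    (fun p ↦ (p.1, p.2 * Equiv.swap i j)) ?_ ?_ ?_ ?_ ?_
  · intro p hp
    simpa [fixingPerms, hk] using hp
  · intro p hp
    simpa [fixingPerms, hk] using hp
  · intro p _
    simp [mul_assoc]
  · intro p _
    simp [mul_assoc]
  · intro p _
    simp

/-- The diagonal averages away from `k` are all equal, and permutations preserve the trace, so each
is an equal share of what the entry at `k` leaves. -/
theorem sum_fixingPerms_diag (k : Fin n) (A : Matrix (Fin n) (Fin n) ℝ) (i : Fin n) :
    ∑ p ∈ fixingPerms k, A (p.2 i) (p.2 i) = (fixingPerms k).card *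
      if i = k then A k k else (A.trace - A k k) / (n - 1) := by
  have hkk : ∑ p ∈ fixingPerms k, A (p.2 k) (p.2 k) = (fixingPerms k).card * A k k := by
    rw [Finset.sum_congr rfl (g := fun _ ↦ A k k), Finset.sum_const, nsmul_eq_mul]
    intro p hp
    simp only [fixingPerms, Finset.mem_filter, Finset.mem_univ, true_and] at hp
    simp [hp.2]
  split_ifs with h
  · rw [h, hkk]
  · have htot : ∑ j, ∑ p ∈ fixingPerms k, A (p.2 j) (p.2 j) = (fixingPerms k).card * A.trace := by
      rw [Finset.sum_comm, Finset.sum_congr rfl (g := fun _ ↦ A.trace), Finset.sum_const,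
        nsmul_eq_mul]
      intro p _
      exact Equiv.sum_comp p.2 fun j ↦ A j j
    rw [← Finset.add_sum_erase _ _ (Finset.mem_univ k), hkk,
      Finset.sum_congr rfl (fun j hj ↦ sum_fixingPerms_diag_eq k A (Finset.ne_of_mem_erase hj) h),
      Finset.sum_const, Finset.card_erase_of_mem (Finset.mem_univ k), Finset.card_univ,
      Fintype.card_fin, nsmul_eq_mul, Nat.cast_pred (Fin.pos k)] at htot
    -- An index different from `k` exists only if `n ≥ 2`.
    have hn : (n : ℝ) - 1 ≠ 0 := by
      have : 2 ≤ n := by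
        by_contra hlt
        exact h (Fin.ext (by omega))
      have : (2 : ℝ) ≤ n := by exact_mod_cast this
      linarith
    field_simp
    linarith

/-- The coefficient matrix `β I + γ x xᵀ`. -/
def radialMatrix (β γ : ℝ) (x : EuclideanSpace ℝ (Fin n)) : Matrix (Fin n) (Fin n) ℝ :=
  β • (1 : Matrix (Fin n) (Fin n) ℝ) + γ • Matrix.vecMulVec x.ofLp x.ofLp

theorem radialMatrix_conj (β γ : ℝ) (x : EuclideanSpace ℝ (Fin n))
    (Q : EuclideanSpace ℝ (Fin n) ≃ₗᵢ[ℝ] EuclideanSpace ℝ (Fin n)) :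
    rotMatrix Q * radialMatrix β γ x * (rotMatrix Q).transpose = radialMatrix β γ (Q x) := by
  simp only [radialMatrix, mul_add, add_mul, Matrix.mul_smul, Matrix.smul_mul, mul_one,
    rotMatrix_mul_transpose, Matrix.mul_vecMulVec, Matrix.vecMulVec_mul, rotMatrix_mulVec,
    Matrix.vecMul_transpose]

theorem sum_signedPerm_conj (k : Fin n) (A : Matrix (Fin n) (Fin n) ℝ) :
    ∑ p ∈ fixingPerms k, rotMatrix (signedPerm p.1 p.2) * A *
        (rotMatrix (signedPerm p.1 p.2)).transpose
      = ((fixingPerms k).card : ℝ) • radialMatrix ((A.trace - A k k) / (n - 1))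
          (A k k - (A.trace - A k k) / (n - 1)) (stdVec k) := by
  have hR : ∀ (p : (Fin n → ℤˣ) × Equiv.Perm (Fin n)) i j, (rotMatrix (signedPerm p.1 p.2) * A *
        (rotMatrix (signedPerm p.1 p.2)).transpose) i j
      = ((p.1 i : ℤ) : ℝ) * ((p.1 j : ℤ) : ℝ) * A (p.2 i) (p.2 j) := by
    intro p i j
    simp [Matrix.mul_apply, rotMatrix, signedPerm_apply]
    ring
  ext i j
  rw [Matrix.sum_apply]
  simp only [hR]
  by_cases hij : i = j
  · subst hij
    have h1 : ∀ p : (Fin n → ℤˣ) × Equiv.Perm (Fin n),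
        ((p.1 i : ℤ) : ℝ) * ((p.1 i : ℤ) : ℝ) = 1 := fun p ↦ by
      rcases Int.units_eq_one_or (p.1 i) with h | h <;> simp [h]
    simp only [h1, one_mul]
    rw [sum_fixingPerms_diag]
    by_cases hi : i = k
    · subst hi
      simp [radialMatrix, Matrix.vecMulVec_apply]
    · simp [radialMatrix, Matrix.vecMulVec_apply, hi]
  · rw [sum_fixingPerms_offDiag k A hij]
    simp only [radialMatrix, Matrix.vecMulVec_apply, Matrix.smul_apply, Matrix.add_apply,
      Matrix.one_apply_ne hij, smul_eq_mul]
    by_cases hi : i = k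
    · have hj : j ≠ k := fun h ↦ hij (hi.trans h.symm)
      simp [hj]
    · simp [hi]

/-- Averaging a matrix and a vector over finitely many isometries carrying the unit vector `f` to
the unit vector `e` gives a rotationally symmetric matrix and a radial vector. -/
theorem exists_average (k : Fin n) {f e : EuclideanSpace ℝ (Fin n)} (hf : ‖f‖ = 1)
    (he : ‖e‖ = 1) (A : Matrix (Fin n) (Fin n) ℝ) (b : EuclideanSpace ℝ (Fin n)) :
    ∃ Q : (Fin n → ℤˣ) × Equiv.Perm (Fin n) →
        EuclideanSpace ℝ (Fin n) ≃ₗᵢ[ℝ] EuclideanSpace ℝ (Fin n),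
      (∀ p ∈ fixingPerms k, Q p f = e) ∧
      ∑ p ∈ fixingPerms k, rotMatrix (Q p) * A * (rotMatrix (Q p)).transpose =
        ((fixingPerms k).card : ℝ) •
          radialMatrix ((A.trace - f.ofLp ⬝ᵥ A.mulVec f.ofLp) / (n - 1))
            (f.ofLp ⬝ᵥ A.mulVec f.ofLp
              - (A.trace - f.ofLp ⬝ᵥ A.mulVec f.ofLp) / (n - 1)) e ∧
      ∑ p ∈ fixingPerms k, Q p b = (((fixingPerms k).card : ℝ) * inner ℝ b f) • e := by
  have hk : ‖stdVec k‖ = 1 := by simp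
  -- The isometries have the form `Q₁ ∘ P ∘ Q₀`: `Q₀` takes `f` to the basis vector at `k`, the
  -- signed permutation `P` fixes that vector, and `Q₁` takes it to `e`.
  obtain ⟨Q₀, hQ₀⟩ := exists_isometry_map_eq (hf.trans hk.symm)
  obtain ⟨Q₁, hQ₁⟩ := exists_isometry_map_eq (hk.trans he.symm)
  have hkk : (rotMatrix Q₀ * A * (rotMatrix Q₀).transpose) k k = f.ofLp ⬝ᵥ A.mulVec f.ofLp := by
    have h1 : (rotMatrix Q₀).transpose.mulVec (stdVec k).ofLp = f.ofLp := by
      rw [← rotMatrix_symm, rotMatrix_mulVec, ← hQ₀, LinearIsometryEquiv.symm_apply_apply]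
    have h2 : ∀ B : Matrix (Fin n) (Fin n) ℝ,
        B k k = (stdVec k).ofLp ⬝ᵥ B.mulVec (stdVec k).ofLp := fun B ↦ by simp
    refine (h2 _).trans ?_
    rw [← Matrix.mulVec_mulVec, ← Matrix.mulVec_mulVec, h1, Matrix.dotProduct_mulVec,
      ← Matrix.mulVec_transpose, h1]
  have htr : (rotMatrix Q₀ * A * (rotMatrix Q₀).transpose).trace = A.trace := by
    rw [Matrix.trace_mul_comm, ← mul_assoc, mul_eq_one_comm.1 (rotMatrix_mul_transpose Q₀),
      one_mul]
  refine ⟨fun p ↦ (Q₀.trans (signedPerm p.1 p.2)).trans Q₁, ?_, ?_, ?_⟩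
  · intro p hp
    simp [hQ₀, signedPerm_stdVec hp, hQ₁]
  · rw [← hkk, ← htr, ← hQ₁, ← radialMatrix_conj]
    have := congrArg (fun T ↦ rotMatrix Q₁ * T * (rotMatrix Q₁).transpose)
      (sum_signedPerm_conj k (rotMatrix Q₀ * A * (rotMatrix Q₀).transpose))
    simp only [Matrix.mul_smul, Matrix.smul_mul] at this
    rw [← this, Matrix.mul_sum, Matrix.sum_mul]
    refine Finset.sum_congr rfl fun p _ ↦ ?_
    simp only [rotMatrix_trans, Matrix.transpose_mul, mul_assoc]
  · have h1 : ∑ p ∈ fixingPerms k, signedPerm p.1 p.2 (Q₀ b)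
        = (((fixingPerms k).card : ℝ) * inner ℝ b f) • stdVec k := by
      ext i
      have h2 : inner ℝ b f = Q₀ b k := by
        rw [← Q₀.inner_map_map, hQ₀, EuclideanSpace.inner_single_right]
        simp
      have := sum_fixingPerms_vec k (Q₀ b).ofLp i
      simp only [WithLp.ofLp_sum, Finset.sum_apply, signedPerm_apply, this, h2]
      simp
    have := congrArg Q₁ h1
    rw [map_sum, map_smul, hQ₁] at this
    exact this

end Averaging

/-! ### Transported operators and the rotationally symmetric average -/

section Operators

open LinOp

variable {n : ℕ}

/-- `Q` is linear, so its second derivative drops out of the chain rule and the coefficients are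
merely conjugated. -/
theorem LinOp.apply_comp_isometry (L : LinOp n)
    (Q : EuclideanSpace ℝ (Fin n) ≃ₗᵢ[ℝ] EuclideanSpace ℝ (Fin n))
    {x y : EuclideanSpace ℝ (Fin n)} (hxy : Q x = y) {u : EuclideanSpace ℝ (Fin n) → ℝ}
    (hu : ContDiffAt ℝ 2 u y) :
    L.apply (u ∘ Q) x =
      ∑ i, ∑ j, (rotMatrix Q * L.a x * (rotMatrix Q).transpose) i j *
        fderiv ℝ (fderiv ℝ u) y (stdVec i) (stdVec j) + fderiv ℝ u y (Q (L.b x)) := by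
  subst hxy
  have hQ : ContDiff ℝ 2 Q := Q.contDiff
  have hQ' : fderiv ℝ Q = fun _ ↦ (Q : EuclideanSpace ℝ (Fin n) →L[ℝ] EuclideanSpace ℝ (Fin n)) :=
    funext fun z ↦ Q.toContinuousLinearEquiv.fderiv
  have hD : ∀ i j, fderiv ℝ (fderiv ℝ (u ∘ Q)) x (stdVec i) (stdVec j)
      = ((rotMatrix Q).transpose * Matrix.of (fun k l ↦
        fderiv ℝ (fderiv ℝ u) (Q x) (stdVec k) (stdVec l)) * rotMatrix Q) i j := by
    intro i j
    rw [fderiv_fderiv_comp hQ.contDiffAt hu, hQ', bilin_expand (fderiv ℝ (fderiv ℝ u) (Q x))]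
    simp only [Matrix.mul_apply, Matrix.transpose_apply, Matrix.of_apply, Finset.sum_mul,
      rotMatrix, smul_eq_mul]
    rw [Finset.sum_comm]
    simp only [fderiv_fun_const, Pi.zero_apply, zero_apply, map_zero, add_zero]
    refine Finset.sum_congr rfl fun k _ ↦ Finset.sum_congr rfl fun l _ ↦ ?_
    simp
    ring
  rw [LinOp.apply_eq _ (hu.comp x hQ.contDiffAt)]
  simp only [hD]
  rw [sum_mul_conj, fderiv_comp x (hu.differentiableAt (by norm_num))
    (hQ.contDiffAt.differentiableAt (by norm_num)), hQ']
  simp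

theorem LinOp.transport_apply (L : LinOp n)
    (ξ : EuclideanSpace ℝ (Fin n) → EuclideanSpace ℝ (Fin n))
    (Q : EuclideanSpace ℝ (Fin n) → EuclideanSpace ℝ (Fin n) ≃ₗᵢ[ℝ] EuclideanSpace ℝ (Fin n))
    {x : EuclideanSpace ℝ (Fin n)} (hx : Q x (ξ x) = x)
    {u : EuclideanSpace ℝ (Fin n) → ℝ} (hu : ContDiffAt ℝ 2 u x) :
    (L.transport ξ Q).apply u x = L.apply (u ∘ Q x) (ξ x) := by
  rw [L.apply_comp_isometry (Q x) hx hu, LinOp.apply_eq _ hu]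
  rfl

theorem posDef_rotMatrix_conj {A : Matrix (Fin n) (Fin n) ℝ} (hA : A.PosDef)
    (Q : EuclideanSpace ℝ (Fin n) ≃ₗᵢ[ℝ] EuclideanSpace ℝ (Fin n)) :
    (rotMatrix Q * A * (rotMatrix Q).transpose).PosDef := by
  rw [← Matrix.conjTranspose_eq_transpose_of_trivial]
  refine hA.mul_mul_conjTranspose_same (Function.LeftInverse.injective
    (g := fun w ↦ Matrix.vecMul w (rotMatrix Q).transpose) fun v ↦ ?_)
  change Matrix.vecMul (Matrix.vecMul v (rotMatrix Q)) (rotMatrix Q).transpose = v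
  rw [Matrix.vecMul_vecMul, rotMatrix_mul_transpose, Matrix.vecMul_one]

/-- The second order coefficient of `L` at `ξ r` in the direction of `ξ r`. -/
def radialCoeff (L : LinOp n) (ξ : ℝ → EuclideanSpace ℝ (Fin n)) (r : ℝ) : ℝ :=
  ((ξ r).ofLp ⬝ᵥ (L.a (ξ r)).mulVec (ξ r).ofLp) / r ^ 2

/-- The mean second order coefficient of `L` at `ξ r` in the directions orthogonal to `ξ r`
(in all directions if `r = 0`). -/
def tangentialCoeff (L : LinOp n) (ξ : ℝ → EuclideanSpace ℝ (Fin n)) (r : ℝ) : ℝ :=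
  if r = 0 then (L.a (ξ r)).trace / n else ((L.a (ξ r)).trace - radialCoeff L ξ r) / (n - 1)

/-- The rotationally symmetric operator whose coefficients on the sphere of radius `r` are
those of `L` at `ξ r`. -/
def rotSymmOp (L : LinOp n) (ξ : ℝ → EuclideanSpace ℝ (Fin n)) : LinOp n where
  a x := radialMatrix (tangentialCoeff L ξ ‖x‖)
    ((radialCoeff L ξ ‖x‖ - tangentialCoeff L ξ ‖x‖) / ‖x‖ ^ 2) x
  b x := (inner ℝ (L.b (ξ ‖x‖)) (ξ ‖x‖) / ‖x‖ ^ 2) • x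

theorem rotSymmOp_isRotSymmOn (L : LinOp n) (ξ : ℝ → EuclideanSpace ℝ (Fin n)) (R : ℝ) :
    (rotSymmOp L ξ).IsRotSymmOn R := by
  intro Q x _ u hu
  rw [LinOp.apply_comp_isometry _ Q rfl hu, LinOp.apply_eq _ hu]
  simp only [rotSymmOp, radialMatrix_conj, Q.norm_map, map_smul]

theorem radialMatrix_smul (β γ c : ℝ) (x : EuclideanSpace ℝ (Fin n)) :
    radialMatrix β γ (c • x) = radialMatrix β (γ * c ^ 2) x := by
  ext i j
  simp [radialMatrix, Matrix.vecMulVec_apply]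
  ring

theorem dotProduct_self_eq_norm_sq (x : EuclideanSpace ℝ (Fin n)) :
    x.ofLp ⬝ᵥ x.ofLp = ‖x‖ ^ 2 := by
  rw [EuclideanSpace.real_norm_sq_eq]
  simp [dotProduct, sq]

theorem trace_radialMatrix (β γ : ℝ) (x : EuclideanSpace ℝ (Fin n)) :
    (radialMatrix β γ x).trace = n * β + γ * ‖x‖ ^ 2 := by
  rw [← dotProduct_self_eq_norm_sq]
  simp [radialMatrix, Matrix.trace_add, Matrix.trace_vecMulVec, mul_comm]

theorem trace_rotMatrix_conj (A : Matrix (Fin n) (Fin n) ℝ)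
    (Q : EuclideanSpace ℝ (Fin n) ≃ₗᵢ[ℝ] EuclideanSpace ℝ (Fin n)) :
    (rotMatrix Q * A * (rotMatrix Q).transpose).trace = A.trace := by
  rw [Matrix.trace_mul_comm, ← mul_assoc, mul_eq_one_comm.1 (rotMatrix_mul_transpose Q), one_mul]

/-- The coefficients of `rotSymmOp L ξ` at `x` are the average of those of `L` at `ξ ‖x‖`,
carried over by finitely many isometries taking `ξ ‖x‖` to `x`. -/
theorem rotSymmOp_eq_average (hn : 0 < n) (L : LinOp n) {ξ : ℝ → EuclideanSpace ℝ (Fin n)}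
    {x : EuclideanSpace ℝ (Fin n)} (hξ : ‖ξ ‖x‖‖ = ‖x‖) :
    ∃ (ι : Type) (S : Finset ι)
      (Q : ι → EuclideanSpace ℝ (Fin n) ≃ₗᵢ[ℝ] EuclideanSpace ℝ (Fin n)),
      S.Nonempty ∧ (∀ p ∈ S, Q p (ξ ‖x‖) = x) ∧
      ∑ p ∈ S, rotMatrix (Q p) * L.a (ξ ‖x‖) * (rotMatrix (Q p)).transpose =
        (S.card : ℝ) • (rotSymmOp L ξ).a x ∧
      ∑ p ∈ S, Q p (L.b (ξ ‖x‖)) = (S.card : ℝ) • (rotSymmOp L ξ).b x := by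
  set k : Fin n := ⟨0, hn⟩
  set N : ℝ := ((fixingPerms k).card : ℝ) with hN
  have hNpos : 0 < N := Nat.cast_pos.2 (fixingPerms_card_pos k)
  rcases eq_or_ne x 0 with rfl | hx
  · rw [norm_zero, norm_eq_zero] at hξ
    rw [norm_zero, hξ]
    set A := L.a 0 with hA
    set b := L.b 0
    have hk : ‖stdVec k‖ = 1 := by simp
    -- At the origin every isometry is admissible and no direction is distinguished, so the averages
    -- with axes `±e_q` are averaged again: opposite signs cancel the first order part, and summing
    -- over `q` makes the matrix a multiple of the identity.
    have he : ∀ q : Fin n × ℤˣ, ‖((q.2 : ℤ) : ℝ) • stdVec q.1‖ = 1 := by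
      intro q
      rcases Int.units_eq_one_or q.2 with h | h <;> simp [h]
    choose Q hQ hQA hQb using fun q ↦ exists_average k hk (he q) A b
    set α := (stdVec k).ofLp ⬝ᵥ A.mulVec (stdVec k).ofLp
    set β := (A.trace - α) / (n - 1) with hβ
    -- Comparing traces in the averaging identity also covers `n = 1`, where `β` is a quotient by
    -- zero.
    have htr : A.trace = n * β + (α - β) := by
      have h := congrArg Matrix.trace (hQA (k, 1))
      rw [Matrix.trace_sum, Matrix.trace_smul, trace_radialMatrix, he] at h
      simp only [trace_rotMatrix_conj, Finset.sum_const, nsmul_eq_mul, smul_eq_mul] at h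
      have := mul_left_cancel₀ hNpos.ne' h
      linarith
    refine ⟨(Fin n × ℤˣ) × _, Finset.univ ×ˢ fixingPerms k, fun p ↦ Q p.1 p.2, ?_, ?_, ?_, ?_⟩
    · exact Finset.Nonempty.product ⟨(k, 1), Finset.mem_univ _⟩
        (Finset.card_pos.1 (fixingPerms_card_pos k))
    · intro p _
      simp
    · rw [Finset.sum_product]
      simp only [hQA]
      rw [Finset.card_product, Finset.card_univ, Fintype.card_prod, Fintype.card_fin]
      ext i j
      rw [Matrix.sum_apply, Fintype.sum_prod_type]
      have hnn : (n : ℝ) ≠ 0 := by positivity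
      simp only [radialMatrix_smul, rotSymmOp, tangentialCoeff, norm_zero, hξ, ← hA]
      by_cases hij : i = j
      · subst hij
        have : ∀ l : Fin n, (Pi.single l 1 : Fin n → ℝ) i * (Pi.single l 1 : Fin n → ℝ) i
            = if i = l then 1 else 0 := fun l ↦ by
          by_cases h : i = l <;> simp [h]
        simp only [radialMatrix, Matrix.vecMulVec_apply, UnitsInt.univ, this, Matrix.smul_apply,
          Matrix.add_apply, Matrix.one_apply_eq, smul_eq_mul, if_true, PiLp.ofLp_single,
          mul_add, Finset.sum_add_distrib, Finset.sum_const, mul_ite, mul_one,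
          mul_zero, htr]
        simp [← hN]
        field_simp
        ring
      · have : ∀ l : Fin n, (Pi.single l 1 : Fin n → ℝ) i * (Pi.single l 1 : Fin n → ℝ) j = 0 := by
          intro l
          by_cases h : i = l
          · subst h
            simp [Ne.symm hij]
          · simp [h]
        simp [radialMatrix, Matrix.vecMulVec_apply, hij, this]
    · rw [Finset.sum_product]
      simp only [hQb]
      rw [Fintype.sum_prod_type]
      simp [rotSymmOp, UnitsInt.univ]
  · have hr : ‖x‖ ≠ 0 := norm_ne_zero_iff.2 hx
    have hf : ‖‖x‖⁻¹ • ξ ‖x‖‖ = 1 := by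
      rw [norm_smul, hξ, norm_inv, norm_norm, inv_mul_cancel₀ hr]
    have he : ‖‖x‖⁻¹ • x‖ = 1 := by
      rw [norm_smul, norm_inv, norm_norm, inv_mul_cancel₀ hr]
    obtain ⟨Q, hQ, hQA, hQb⟩ := exists_average k hf he (L.a (ξ ‖x‖)) (L.b (ξ ‖x‖))
    have hα : (‖x‖⁻¹ • ξ ‖x‖).ofLp ⬝ᵥ (L.a (ξ ‖x‖)).mulVec (‖x‖⁻¹ • ξ ‖x‖).ofLp
        = radialCoeff L ξ ‖x‖ := by
      simp [radialCoeff, Matrix.mulVec_smul]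
      field_simp
    refine ⟨_, fixingPerms k, Q, Finset.card_pos.1 (fixingPerms_card_pos k), ?_, ?_, ?_⟩
    · intro p hp
      have := hQ p hp
      rw [map_smul] at this
      exact smul_right_injective _ (inv_ne_zero hr) this
    · rw [hQA, hα, radialMatrix_smul]
      simp only [rotSymmOp, tangentialCoeff, if_neg hr, div_eq_mul_inv, inv_pow]
    · rw [hQb]
      simp only [rotSymmOp, inner_smul_right, smul_smul]
      congr 1
      field_simp

/-- An average of conjugates of a positive definite matrix is positive definite, which spares an
estimate of the individual coefficients. -/
theorem rotSymmOp_posDef (hn : 0 < n) (L : LinOp n) {ξ : ℝ → EuclideanSpace ℝ (Fin n)}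
    {x : EuclideanSpace ℝ (Fin n)} (hξ : ‖ξ ‖x‖‖ = ‖x‖) (hL : (L.a (ξ ‖x‖)).PosDef) :
    ((rotSymmOp L ξ).a x).PosDef := by
  obtain ⟨ι, S, Q, hS, -, hA, -⟩ := rotSymmOp_eq_average hn L hξ
  have hc : (0 : ℝ) < S.card := by exact_mod_cast hS.card_pos
  have h : ((S.card : ℝ) • (rotSymmOp L ξ).a x).PosDef := by
    rw [← hA]
    exact Matrix.posDef_sum hS fun p _ ↦ posDef_rotMatrix_conj hL (Q p)
  have := h.smul (inv_pos.2 hc)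
  rwa [smul_smul, inv_mul_cancel₀ hc.ne', one_smul] at this

/-- An inequality that holds after all rotations taking `ξ ‖x‖` to `x` holds for the
rotationally symmetric operator. -/
theorem rotSymmOp_apply_nonpos (hn : 0 < n) (L : LinOp n) {ξ : ℝ → EuclideanSpace ℝ (Fin n)}
    {x : EuclideanSpace ℝ (Fin n)} (hξ : ‖ξ ‖x‖‖ = ‖x‖) {u : EuclideanSpace ℝ (Fin n) → ℝ}
    (hu : ContDiffAt ℝ 2 u x)
    (h : ∀ Q : EuclideanSpace ℝ (Fin n) ≃ₗᵢ[ℝ] EuclideanSpace ℝ (Fin n), Q (ξ ‖x‖) = x →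
      L.apply (u ∘ Q) (ξ ‖x‖) ≤ 0) :
    (rotSymmOp L ξ).apply u x ≤ 0 := by
  obtain ⟨ι, S, Q, hS, hQ, hA, hb⟩ := rotSymmOp_eq_average hn L hξ
  have hc : (0 : ℝ) < S.card := by exact_mod_cast hS.card_pos
  have e : (S.card : ℝ) * (rotSymmOp L ξ).apply u x = ∑ p ∈ S, L.apply (u ∘ Q p) (ξ ‖x‖) := by
    rw [Finset.sum_congr rfl fun p hp ↦ L.apply_comp_isometry (Q p) (hQ p hp) hu,
      Finset.sum_add_distrib, ← map_sum, hb, LinOp.apply_eq _ hu, map_smul, smul_eq_mul, mul_add]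
    congr 1
    have hA' : ∀ i j, (S.card : ℝ) * (rotSymmOp L ξ).a x i j = ∑ p ∈ S,
        (rotMatrix (Q p) * L.a (ξ ‖x‖) * (rotMatrix (Q p)).transpose) i j := fun i j ↦ by
      rw [← Matrix.sum_apply, hA, Matrix.smul_apply, smul_eq_mul]
    simp only [Finset.mul_sum, ← mul_assoc, hA', Finset.sum_mul]
    rw [Finset.sum_comm' (t' := Finset.univ) (s' := fun _ ↦ S) (by simp)]
    refine Finset.sum_congr rfl fun i _ ↦ ?_
    rw [Finset.sum_comm]
  have h2 : ∑ p ∈ S, L.apply (u ∘ Q p) (ξ ‖x‖) ≤ 0 :=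
    Finset.sum_nonpos fun p hp ↦ h (Q p) (hQ p hp)
  rw [← e] at h2
  exact nonpos_of_mul_nonpos_right h2 hc

theorem rotSymmOp_sameRotCoeff (hn : 0 < n) (L : LinOp n) {ξ : ℝ → EuclideanSpace ℝ (Fin n)}
    {x : EuclideanSpace ℝ (Fin n)} (hξ : ‖ξ ‖x‖‖ = ‖x‖) :
    (rotSymmOp L ξ).SameRotCoeff x L (ξ ‖x‖) := by
  have hquad : ∀ (A : Matrix (Fin n) (Fin n) ℝ) (y : EuclideanSpace ℝ (Fin n)),
      ∑ i, ∑ j, A i j * y i * y j = y.ofLp ⬝ᵥ A.mulVec y.ofLp := fun A y ↦ by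
    simp only [dotProduct, Matrix.mulVec, Finset.mul_sum]
    exact Finset.sum_congr rfl fun i _ ↦ Finset.sum_congr rfl fun j _ ↦ by ring
  have hlin : ∀ b y : EuclideanSpace ℝ (Fin n), ∑ i, b i * y i = inner ℝ b y := fun b y ↦ by
    simp [PiLp.inner_apply, mul_comm]
  refine ⟨?_, ?_, ?_⟩
  · rw [hquad, hquad]
    rcases eq_or_ne x 0 with rfl | hx
    · rw [norm_zero, norm_eq_zero] at hξ
      simp [hξ]
    · have hr : ‖x‖ ≠ 0 := norm_ne_zero_iff.2 hx
      have hv : (Matrix.vecMulVec x.ofLp x.ofLp).mulVec x.ofLp = ‖x‖ ^ 2 • x.ofLp := by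
        rw [Matrix.vecMulVec_mulVec, dotProduct_self_eq_norm_sq]
        ext i
        simp [mul_comm]
      simp only [rotSymmOp, radialMatrix, Matrix.add_mulVec, Matrix.smul_mulVec, Matrix.one_mulVec,
        hv, dotProduct_add, dotProduct_smul, dotProduct_self_eq_norm_sq, smul_eq_mul]
      have : (ξ ‖x‖).ofLp ⬝ᵥ (L.a (ξ ‖x‖)).mulVec (ξ ‖x‖).ofLp
          = radialCoeff L ξ ‖x‖ * ‖x‖ ^ 2 := by
        rw [radialCoeff]
        field_simp
      rw [this]
      field_simp
      ring
  -- Conjugation by an isometry preserves the trace, hence so does the average; the cases `x = 0`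
  -- and `n = 1` need no separate treatment.
  · obtain ⟨ι, S, Q, hS, -, hA, -⟩ := rotSymmOp_eq_average hn L hξ
    have hc : (0 : ℝ) < S.card := by exact_mod_cast hS.card_pos
    have h := congrArg Matrix.trace hA
    rw [Matrix.trace_sum, Matrix.trace_smul] at h
    simp only [trace_rotMatrix_conj, Finset.sum_const, nsmul_eq_mul, smul_eq_mul] at h
    exact (mul_left_cancel₀ hc.ne' h).symm
  · rw [hlin, hlin]
    rcases eq_or_ne x 0 with rfl | hx
    · rw [norm_zero, norm_eq_zero] at hξ
      simp [hξ]
    · have hr : ‖x‖ ≠ 0 := norm_ne_zero_iff.2 hx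
      simp only [rotSymmOp, inner_smul_left, real_inner_self_eq_norm_sq]
      simp [hr]

end Operators

/-! ### Exponential coordinates and the maximal radial function -/

section NormalCoordinates

variable {n : ℕ} {M : Type*} [MetricSpace M] [ChartedSpace (EuclideanSpace ℝ (Fin n)) M]

/-- `Φ` is a diffeomorphism of `B_R(0)` onto `B_R(x₀)` with inverse `g`, which carries the
Euclidean distance from `0` to the distance from `x₀`. -/
structure IsPolarDiffeo (x₀ : M) (R : ℝ) (Φ : EuclideanSpace ℝ (Fin n) → M)
    (g : M → EuclideanSpace ℝ (Fin n)) : Prop where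
  isLocalDiffeomorphAt : ∀ x ∈ Metric.ball 0 R, IsLocalDiffeomorphAt (𝓡 n) (𝓡 n) ∞ Φ x
  contMDiffAt_symm : ∀ p ∈ Metric.ball x₀ R, ContMDiffAt (𝓡 n) (𝓡 n) ∞ g p
  left_inv : ∀ x ∈ Metric.ball 0 R, g (Φ x) = x
  right_inv : ∀ p ∈ Metric.ball x₀ R, Φ (g p) = p
  dist_eq : ∀ x ∈ Metric.ball 0 R, dist (Φ x) x₀ = ‖x‖
  norm_symm_eq : ∀ p ∈ Metric.ball x₀ R, ‖g p‖ = dist p x₀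

/-- The identity `d(exp w, x₀) = |w|` is read off from the hypothesis on all radii: the exponential
map takes each `B_r(0)` onto `B_r(x₀)` and is injective on the largest ball, so it preserves every
sublevel set of the distance, hence the distance. -/
theorem exists_isPolarDiffeo [RiemannianBundle (fun x : M => TangentSpace (𝓡 n) x)]
    (x₀ : M) {R : ℝ} (hR : 0 < R) (hball : ∀ r : ℝ, 0 < r → r ≤ R → IsGeodesicBall n x₀ r)
    (ι : EuclideanSpace ℝ (Fin n) ≃ₗᵢ[ℝ] TangentSpace (𝓡 n) x₀) :
    ∃ g, IsPolarDiffeo x₀ R (expCoord x₀ ι) g := by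
  obtain ⟨-, e, hes, het, hee⟩ := hball R hR le_rfl
  have hι : ∀ x r, ι x ∈ Metric.ball (0 : TangentSpace (𝓡 n) x₀) r ↔ x ∈ Metric.ball 0 r := by
    intro x r
    rw [mem_ball_zero_iff, mem_ball_zero_iff, ι.norm_map]
  have hΦ : ∀ x ∈ Metric.ball 0 R, expCoord x₀ ι x = e (ι x) := fun x hx ↦
    (hee ((hι x R).2 hx)).symm
  -- For the forward direction, surjectivity of the diffeomorphism at radius `r` gives a preimage in
  -- the small ball, and injectivity at radius `R` identifies it with `ι x`.
  have hmaps : ∀ x ∈ Metric.ball 0 R, ∀ r, 0 < r → r ≤ R →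
      (dist (expCoord x₀ ι x) x₀ < r ↔ ‖x‖ < r) := by
    intro x hx r hr hrR
    obtain ⟨-, e', hes', het', hee'⟩ := hball r hr hrR
    constructor
    · intro h
      have hmem : expCoord x₀ ι x ∈ e'.target := by rw [het']; exact h
      have h1 : e'.invFun (expCoord x₀ ι x) ∈ Metric.ball (0 : TangentSpace (𝓡 n) x₀) r := by
        rw [← hes']; exact e'.map_target hmem
      have h2 : e (e'.invFun (expCoord x₀ ι x)) = e (ι x) := by
        rw [← hΦ x hx, hee (Metric.ball_subset_ball hrR h1), ← hee' h1]
        exact e'.right_inv hmem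
      have h3 := e.injOn (by rw [hes]; exact Metric.ball_subset_ball hrR h1)
        (by rw [hes]; exact (hι x R).2 hx) h2
      rw [h3, hι] at h1
      exact mem_ball_zero_iff.1 h1
    · intro h
      have h1 : ι x ∈ Metric.ball (0 : TangentSpace (𝓡 n) x₀) r :=
        (hι x r).2 (mem_ball_zero_iff.2 h)
      have h2 : e' (ι x) ∈ e'.target := e'.map_source (by rw [hes']; exact h1)
      rw [het', hee' h1] at h2
      exact h2
  have hdist : ∀ x ∈ Metric.ball 0 R, dist (expCoord x₀ ι x) x₀ = ‖x‖ := by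
    intro x hx
    have hxR := mem_ball_zero_iff.1 hx
    have hdR := (hmaps x hx R hR le_rfl).2 hxR
    rcases lt_trichotomy (dist (expCoord x₀ ι x) x₀) ‖x‖ with h | h | h
    · obtain ⟨r, h1, h2⟩ := exists_between h
      have := (hmaps x hx r (dist_nonneg.trans_lt h1) (h2.le.trans hxR.le)).1 h1
      linarith
    · exact h
    · obtain ⟨r, h1, h2⟩ := exists_between h
      have := (hmaps x hx r ((norm_nonneg x).trans_lt h1) (h2.le.trans hdR.le)).2 h1
      linarith
  set d := ι.toContinuousLinearEquiv.toDiffeomorph.toPartialDiffeomorph (n := ∞) |>.trans e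
  have hds : d.source = Metric.ball 0 R := by
    ext x
    rw [← hι, ← hes]
    exact and_iff_right (mem_univ x)
  have hdt : d.target = Metric.ball x₀ R := by
    rw [← het]
    exact inter_eq_left.2 fun _ _ ↦ mem_univ _
  have hdΦ : EqOn (expCoord x₀ ι) d d.source := by
    intro x hx
    rw [hds] at hx
    exact hΦ x hx
  have hinv : ∀ p ∈ Metric.ball x₀ R, expCoord x₀ ι (d.invFun p) = p := by
    intro p hp
    rw [← hdt] at hp
    exact (hdΦ (d.map_target hp)).trans (d.right_inv hp)
  refine ⟨d.invFun, ?_, ?_, ?_, hinv, hdist, ?_⟩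
  · intro x hx
    exact ⟨d, by rwa [hds], hdΦ⟩
  · intro p hp
    exact d.contMDiffOn_invFun.contMDiffAt (d.open_target.mem_nhds (by rwa [hdt]))
  · intro x hx
    rw [← hds] at hx
    rw [hdΦ hx]
    exact d.left_inv hx
  · intro p hp
    have h1 : d.invFun p ∈ Metric.ball 0 R := by
      rw [← hds]
      exact d.map_target (by rwa [hdt])
    rw [← hdist _ h1, hinv p hp]

variable {x₀ : M} {R : ℝ} {Φ : EuclideanSpace ℝ (Fin n) → M} {g : M → EuclideanSpace ℝ (Fin n)}

theorem IsPolarDiffeo.map_mem_ball (h : IsPolarDiffeo x₀ R Φ g) {x : EuclideanSpace ℝ (Fin n)}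
    (hx : x ∈ Metric.ball 0 R) : Φ x ∈ Metric.ball x₀ R := by
  rw [Metric.mem_ball, h.dist_eq x hx]
  exact mem_ball_zero_iff.1 hx

theorem IsPolarDiffeo.symm_mem_ball (h : IsPolarDiffeo x₀ R Φ g) {p : M}
    (hp : p ∈ Metric.ball x₀ R) : g p ∈ Metric.ball 0 R := by
  rw [mem_ball_zero_iff, h.norm_symm_eq p hp]
  exact hp

theorem IsPolarDiffeo.image_sphere (h : IsPolarDiffeo x₀ R Φ g) {r : ℝ} (hr : r < R) :
    Φ '' Metric.sphere 0 r = Metric.sphere x₀ r := by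
  ext p
  constructor
  · rintro ⟨x, hx, rfl⟩
    rw [mem_sphere_zero_iff_norm] at hx
    rw [Metric.mem_sphere, h.dist_eq x (mem_ball_zero_iff.2 (hx.trans_lt hr)), hx]
  · intro hp
    have hp' : p ∈ Metric.ball x₀ R := (Metric.mem_sphere.1 hp).trans_lt hr
    refine ⟨g p, ?_, h.right_inv p hp'⟩
    rw [mem_sphere_zero_iff_norm, h.norm_symm_eq p hp']
    exact hp

theorem maximalRadial_le {M : Type*} [MetricSpace M] (v : M → EReal) {x₀ p q : M}
    (h : dist q x₀ = dist p x₀) : maximalRadial v x₀ p ≤ v q :=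
  iInf₂_le q h

/-- The sphere is compact as a continuous image of a Euclidean sphere and nonempty since `n > 0`, so
a lower semicontinuous function attains its minimum on it. -/
theorem IsPolarDiffeo.exists_maximalRadial_eq (h : IsPolarDiffeo x₀ R Φ g) (hn : 0 < n)
    {v : M → EReal} (hv : LowerSemicontinuousOn v (Metric.ball x₀ R)) {r : ℝ} (hr : 0 ≤ r)
    (hrR : r < R) : ∃ y ∈ Metric.sphere x₀ r, maximalRadial v x₀ y = v y := by
  have hsub : Metric.sphere x₀ r ⊆ Metric.ball x₀ R := fun p hp ↦
    (Metric.mem_sphere.1 hp).trans_lt hrR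
  have hcomp : IsCompact (Metric.sphere x₀ r) := by
    rw [← h.image_sphere hrR]
    refine (isCompact_sphere 0 r).image_of_continuousOn fun x hx ↦ ?_
    refine (h.isLocalDiffeomorphAt x ?_).contMDiffAt.continuousAt.continuousWithinAt
    exact mem_ball_zero_iff.2 ((mem_sphere_zero_iff_norm.1 hx).trans_lt hrR)
  have hne : (Metric.sphere x₀ r).Nonempty := by
    rw [← h.image_sphere hrR]
    refine Set.Nonempty.image _ ⟨r • stdVec ⟨0, hn⟩, ?_⟩
    simp [norm_smul, abs_of_nonneg hr]
  obtain ⟨y, hy, hmin⟩ := (hv.mono hsub).exists_isMinOn hne hcomp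
  refine ⟨y, hy, le_antisymm (maximalRadial_le v rfl) ?_⟩
  refine le_iInf₂ fun q hq ↦ hmin ?_
  rwa [Metric.mem_sphere, Metric.mem_sphere.1 hy] at hq

theorem maximalRadial_congr {M : Type*} [MetricSpace M] (v : M → EReal) {x₀ p q : M}
    (h : dist p x₀ = dist q x₀) : maximalRadial v x₀ p = maximalRadial v x₀ q := by
  simp only [maximalRadial, h]

/-- All spheres are parametrized by one compact set, the unit sphere, through `z ↦ Φ (‖y‖ • z)`.
Compactness makes the lower bound on `v` uniform in `z` for `y` near `x`, and attainment of the
infimum keeps the inequality strict. -/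
theorem IsPolarDiffeo.lowerSemicontinuousOn (h : IsPolarDiffeo x₀ R Φ g) (hn : 0 < n)
    {v : M → EReal} (hv : LowerSemicontinuousOn v (Metric.ball x₀ R)) :
    LowerSemicontinuousOn (maximalRadial v x₀ ∘ Φ) (Metric.ball 0 R) := by
  intro x hx c hc
  have hxR := mem_ball_zero_iff.1 hx
  have hmem : ∀ y z : EuclideanSpace ℝ (Fin n), y ∈ Metric.ball 0 R → ‖z‖ = 1 →
      ‖y‖ • z ∈ Metric.ball 0 R := fun y z hy hz ↦ by
    rw [mem_ball_zero_iff] at hy ⊢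
    rwa [norm_smul, hz, norm_norm, mul_one]
  have hev : ∀ᶠ y in 𝓝 x, ∀ z ∈ Metric.sphere (0 : EuclideanSpace ℝ (Fin n)) 1,
      c < v (Φ (‖y‖ • z)) := by
    refine (isCompact_sphere _ 1).eventually_forall_of_forall_eventually fun z hz ↦ ?_
    rw [mem_sphere_zero_iff_norm] at hz
    have hb := hmem x z hx hz
    have hlt : c < v (Φ (‖x‖ • z)) := by
      refine lt_of_lt_of_le hc (maximalRadial_le v ?_)
      rw [h.dist_eq _ hb, h.dist_eq x hx, norm_smul, hz, norm_norm, mul_one]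
    have h1 : ∀ᶠ p in 𝓝 (Φ (‖x‖ • z)), c < v p := by
      have := hv _ (h.map_mem_ball hb) c hlt
      rwa [Metric.isOpen_ball.nhdsWithin_eq (h.map_mem_ball hb)] at this
    have h2 : ContinuousAt (fun q : EuclideanSpace ℝ (Fin n) × EuclideanSpace ℝ (Fin n) ↦
        Φ (‖q.1‖ • q.2)) (x, z) :=
      ContinuousAt.comp (f := fun q : EuclideanSpace ℝ (Fin n) × EuclideanSpace ℝ (Fin n) ↦
        ‖q.1‖ • q.2) (h.isLocalDiffeomorphAt _ hb).contMDiffAt.continuousAt (by fun_prop)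
    exact h2.eventually h1
  filter_upwards [nhdsWithin_le_nhds hev, self_mem_nhdsWithin] with y hy hyR
  have hyR' := mem_ball_zero_iff.1 hyR
  obtain ⟨q, hq, hqv⟩ := h.exists_maximalRadial_eq hn hv (norm_nonneg y) hyR'
  rw [Metric.mem_sphere] at hq
  rw [Function.comp_apply, maximalRadial_congr v ((h.dist_eq y hyR).trans hq.symm), hqv]
  have hqR : q ∈ Metric.ball x₀ R := hq.trans_lt hyR'
  have hgq := (h.norm_symm_eq q hqR).trans hq
  rw [← h.right_inv q hqR]
  -- At radius zero the minimum point has no direction, and any unit vector represents it.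
  rcases eq_or_ne ‖y‖ 0 with h0 | h0
  · have := hy (stdVec ⟨0, hn⟩) (by simp)
    rw [h0] at hgq this
    rwa [norm_eq_zero.1 hgq, ← zero_smul ℝ (stdVec ⟨0, hn⟩)]
  · have := hy (‖y‖⁻¹ • g q) (by
      rw [mem_sphere_zero_iff_norm, norm_smul, hgq, norm_inv, norm_norm, inv_mul_cancel₀ h0])
    rwa [smul_smul, mul_inv_cancel₀ h0, one_smul] at this

/-- A function touching the maximal radial function from below at `x`, carried over by an
isometry taking `ξ` to `x`, touches `v` from below at the point with coordinates `ξ`. -/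
theorem IsPolarDiffeo.laplaceIn_apply_comp_nonpos [IsManifold (𝓡 n) ∞ M]
    [RiemannianBundle (fun x : M => TangentSpace (𝓡 n) x)]
    [IsContMDiffRiemannianBundle (𝓡 n) ∞ (EuclideanSpace ℝ (Fin n))
      (fun x : M => TangentSpace (𝓡 n) x)]
    (h : IsPolarDiffeo x₀ R Φ g) {v : M → EReal}
    (hv : IsSuperharmonicOn n v (Metric.ball x₀ R)) {x ξ : EuclideanSpace ℝ (Fin n)}
    (hx : x ∈ Metric.ball 0 R)
    (Q : EuclideanSpace ℝ (Fin n) ≃ₗᵢ[ℝ] EuclideanSpace ℝ (Fin n)) (hQ : Q ξ = x)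
    (hξv : maximalRadial v x₀ (Φ ξ) = v (Φ ξ)) {φ : EuclideanSpace ℝ (Fin n) → ℝ}
    (hφ : ContDiffAt ℝ 2 φ x) (hφx : (φ x : EReal) = maximalRadial v x₀ (Φ x))
    (hle : ∀ᶠ y in 𝓝 x, (φ y : EReal) ≤ maximalRadial v x₀ (Φ y)) :
    (laplaceIn Φ).apply (φ ∘ Q) ξ ≤ 0 := by
  subst hQ
  have hξ : ξ ∈ Metric.ball 0 R := by
    rw [mem_ball_zero_iff] at hx ⊢
    rwa [Q.norm_map] at hx
  have hp := h.map_mem_ball hξ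
  have hgp := h.left_inv ξ hξ
  have hg := h.contMDiffAt_symm _ hp
  have hf : ContMDiffAt (𝓡 n) 𝓘(ℝ, ℝ) 2 ((φ ∘ Q) ∘ g) (Φ ξ) := by
    refine ContMDiffAt.comp (Φ ξ) ?_ (hg.of_le two_le_infty)
    rw [hgp]
    exact (hφ.comp ξ Q.contDiff.contDiffAt).contMDiffAt
  have hQg : Tendsto (fun q ↦ Q (g q)) (𝓝 (Φ ξ)) (𝓝 (Q ξ)) := by
    have := (Q.continuous.continuousAt (x := g (Φ ξ))).comp hg.continuousAt
    rw [ContinuousAt, Function.comp_apply, hgp] at this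
    exact this
  -- Contact at `Φ ξ`: `φ (Q ξ) = ṽ (Φ (Q ξ)) = ṽ (Φ ξ) = v (Φ ξ)`, as `Q` preserves the radius.
  -- Nearby: `φ (Q (g q)) ≤ ṽ (Φ (Q (g q))) ≤ v q`, as `Φ (Q (g q))` and `q` have the same distance
  -- to `x₀`.
  have key := hv.2.2 (Φ ξ) hp ((φ ∘ Q) ∘ g) hf (by
      rw [Function.comp_apply, Function.comp_apply, hgp, hφx, ← hξv]
      refine maximalRadial_congr v ?_
      rw [h.dist_eq _ hx, h.dist_eq _ hξ, Q.norm_map]) (by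
      filter_upwards [hQg.eventually hle, Metric.isOpen_ball.mem_nhds hp] with q hq hqR
      refine hq.trans (maximalRadial_le v ?_)
      have hgq := h.symm_mem_ball hqR
      rw [h.dist_eq, Q.norm_map, h.norm_symm_eq q hqR]
      rw [mem_ball_zero_iff] at hgq ⊢
      rwa [Q.norm_map])
  rw [laplacian_eq_laplaceIn (h.isLocalDiffeomorphAt ξ hξ) hf] at key
  rw [LinOp.apply_congr _ (w := ((φ ∘ Q) ∘ g) ∘ Φ)]
  · exact key
  · filter_upwards [Metric.isOpen_ball.mem_nhds hξ] with y hy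
    simp [h.left_inv y hy]

end NormalCoordinates

end MaxRadial

end

/-! ### The theorem, assembled from the touching argument and the average -/

theorem mainTheorem2 {n : ℕ} (hn : 0 < n) {M : Type*} [MetricSpace M]
    [ChartedSpace (EuclideanSpace ℝ (Fin n)) M] [IsManifold (𝓡 n) ∞ M]
    [RiemannianBundle (fun x : M => TangentSpace (𝓡 n) x)]
    [IsContMDiffRiemannianBundle (𝓡 n) ∞ (EuclideanSpace ℝ (Fin n))
      (fun x : M => TangentSpace (𝓡 n) x)]
    [IsRiemannianManifold (𝓡 n) M]
    (x₀ : M) (R : ℝ) (hR : 0 < R)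
    (hball : ∀ r : ℝ, 0 < r → r ≤ R → MaxRadial.IsGeodesicBall n x₀ r)
    (v : M → EReal) (hv : MaxRadial.IsSuperharmonicOn n v (Metric.ball x₀ R))
    (ι : EuclideanSpace ℝ (Fin n) ≃ₗᵢ[ℝ] TangentSpace (𝓡 n) x₀) :
    -- the infimum over each geodesic sphere is attained
    (∀ r ∈ Ico (0 : ℝ) R, ∃ y ∈ Metric.sphere x₀ r, MaxRadial.maximalRadial v x₀ y = v y) ∧
    -- for every choice `p r` of the minimum points `x_r`
    ∀ p : ℝ → M,
      (∀ r ∈ Ico (0 : ℝ) R,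
        p r ∈ Metric.sphere x₀ r ∧ MaxRadial.maximalRadial v x₀ (p r) = v (p r)) →
      -- with exponential coordinates `ξ r` of `x_r`
      ∃ ξ : ℝ → EuclideanSpace ℝ (Fin n),
        (∀ r ∈ Ico (0 : ℝ) R, ‖ξ r‖ = r ∧ MaxRadial.expCoord x₀ ι (ξ r) = p r) ∧
        (∃ L : MaxRadial.LinOp n,
          L.IsEllipticOn (Metric.ball 0 R) ∧ L.IsRotSymmOn R ∧
          (∀ x ∈ Metric.ball (0 : EuclideanSpace ℝ (Fin n)) R,
            L.SameRotCoeff x (MaxRadial.laplaceIn (MaxRadial.expCoord x₀ ι)) (ξ ‖x‖)) ∧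
          L.IsSuperharmonicOn (MaxRadial.maximalRadial v x₀ ∘ MaxRadial.expCoord x₀ ι)
            (Metric.ball 0 R)) ∧
        -- the coefficients at `x_r` themselves, carried to `x` by any isometry taking `x_r` to `x`
        (∀ Q : EuclideanSpace ℝ (Fin n) →
            EuclideanSpace ℝ (Fin n) ≃ₗᵢ[ℝ] EuclideanSpace ℝ (Fin n),
          (∀ x ∈ Metric.ball (0 : EuclideanSpace ℝ (Fin n)) R, Q x (ξ ‖x‖) = x) →
          ((MaxRadial.laplaceIn (MaxRadial.expCoord x₀ ι)).transport
              (fun x => ξ ‖x‖) Q).IsEllipticOn (Metric.ball 0 R) ∧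
          ((MaxRadial.laplaceIn (MaxRadial.expCoord x₀ ι)).transport
              (fun x => ξ ‖x‖) Q).IsSuperharmonicOn
            (MaxRadial.maximalRadial v x₀ ∘ MaxRadial.expCoord x₀ ι) (Metric.ball 0 R)) := by
  obtain ⟨g, h⟩ := MaxRadial.exists_isPolarDiffeo x₀ hR hball ι
  -- From here on only the polar diffeomorphism properties of exponential coordinates matter, not
  -- geodesics.
  generalize MaxRadial.expCoord x₀ ι = Φ at h ⊢
  have hatt := fun (r : ℝ) (hr : r ∈ Ico (0 : ℝ) R) ↦
    h.exists_maximalRadial_eq hn hv.1 hr.1 hr.2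
  refine ⟨hatt, fun p hp ↦ ?_⟩
  have hpR : ∀ r ∈ Ico (0 : ℝ) R, p r ∈ Metric.ball x₀ R := fun r hr ↦
    (Metric.mem_sphere.1 (hp r hr).1).trans_lt hr.2
  have hIco : ∀ x ∈ Metric.ball (0 : EuclideanSpace ℝ (Fin n)) R, ‖x‖ ∈ Ico (0 : ℝ) R :=
    fun x hx ↦ ⟨norm_nonneg x, mem_ball_zero_iff.1 hx⟩
  have hξ : ∀ r ∈ Ico (0 : ℝ) R, ‖g (p r)‖ = r ∧ Φ (g (p r)) = p r := fun r hr ↦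
    ⟨(h.norm_symm_eq _ (hpR r hr)).trans (hp r hr).1, h.right_inv _ (hpR r hr)⟩
  have hξv : ∀ r ∈ Ico (0 : ℝ) R,
      MaxRadial.maximalRadial v x₀ (Φ (g (p r))) = v (Φ (g (p r))) := fun r hr ↦ by
    rw [(hξ r hr).2]
    exact (hp r hr).2
  have hlsc := h.lowerSemicontinuousOn hn hv.1
  have hbot : ∀ x ∈ Metric.ball (0 : EuclideanSpace ℝ (Fin n)) R,
      ⊥ < (MaxRadial.maximalRadial v x₀ ∘ Φ) x := fun x hx ↦ by
    have hxI := hIco x hx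
    rw [Function.comp_apply, MaxRadial.maximalRadial_congr v
      ((h.dist_eq x hx).trans (hp ‖x‖ hxI).1.symm), (hp ‖x‖ hxI).2]
    exact hv.2.1 _ (hpR _ hxI)
  have hpos : ∀ x ∈ Metric.ball (0 : EuclideanSpace ℝ (Fin n)) R,
      ((MaxRadial.laplaceIn Φ).a (g (p ‖x‖))).PosDef := fun x hx ↦ by
    have hloc := h.isLocalDiffeomorphAt _ (h.symm_mem_ball (hpR _ (hIco x hx)))
    exact (MaxRadial.metricCoeff_posDef
      (hloc.mfderivToContinuousLinearEquiv (by simp)).injective).inv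
  refine ⟨fun r ↦ g (p r), hξ, ⟨MaxRadial.rotSymmOp (MaxRadial.laplaceIn Φ) fun r ↦ g (p r),
    ?_, ?_, ?_, hlsc, hbot, ?_⟩, fun Q hQ ↦ ⟨?_, hlsc, hbot, ?_⟩⟩
  · exact fun x hx ↦ MaxRadial.rotSymmOp_posDef hn (MaxRadial.laplaceIn Φ) (ξ := fun r ↦ g (p r)) (hξ _ (hIco x hx)).1 (hpos x hx)
  · exact MaxRadial.rotSymmOp_isRotSymmOn _ _ R
  · exact fun x hx ↦ MaxRadial.rotSymmOp_sameRotCoeff hn (MaxRadial.laplaceIn Φ) (ξ := fun r ↦ g (p r)) (hξ _ (hIco x hx)).1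
  · intro x hx φ hφ hφx hle
    exact MaxRadial.rotSymmOp_apply_nonpos hn (MaxRadial.laplaceIn Φ) (ξ := fun r ↦ g (p r)) (hξ _ (hIco x hx)).1 hφ fun Q hQx ↦
      h.laplaceIn_apply_comp_nonpos hv hx Q hQx (hξv _ (hIco x hx)) hφ hφx hle
  · exact fun x hx ↦ MaxRadial.posDef_rotMatrix_conj (hpos x hx) (Q x)
  · intro x hx φ hφ hφx hle
    rw [MaxRadial.LinOp.transport_apply _ (fun x ↦ g (p ‖x‖)) Q (hQ x hx) hφ]
    exact h.laplaceIn_apply_comp_nonpos hv hx (Q x) (hQ x hx) (hξv _ (hIco x hx)) hφ hφx hle
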